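/- Maximal depth is defined for a pair $(R,\mathfrak m)$ that is either a Noetherian local ring with its maximal ideal or a standard graded $K$-algebra ($R_0=K$, generated over $K$ by finitely many elements of degree one) with its graded maximal ideal, and for a nonzero finitely generated $R$-module $L$ (carrying a $\mathbb Z$-grading compatible with that of $R$ in the graded case): let $\operatorname{depth} L$ be the supremum of the lengths of $L$-regular sequences in $\mathfrak m$, and let $\operatorname{mdepth} L=\min\{\dim R/\mathfrak p : \mathfrak p\in\operatorname{Ass}_R(L)\}$. The module $L$ has \emph{maximal depth} if $\operatorname{depth} L=\operatorname{mdepth} L$. Proposition. Let $K$ be an algebraically closed field, let $A$ and $B$ be commutative Noetherian $K$-algebras such that $R=A\otimes_K B$ is Noetherian, and let $M$ and $N$ be nonzero finitely generated modules over $A$ and $B$, respectively. View $M\otimes_K N$ as an $R$-module through $(a\otimes b)(x\otimes y)=ax\otimes by$. Suppose that one of the following holds: (i) $A$, $B$ and $R$ are local rings, with their maximal ideals; or (ii) $A$ and $B$ are standard graded $K$-algebras, $M$ and $N$ are $\mathbb Z$-graded modules over them, and $R$ carries the grading $R_n=\sum_{i+j=n}A_i\otimes_K B_j$, with graded maximal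 ideals. Then $M\otimes_K N$ has maximal depth as an $R$-module if and only if both $M$ and $N$ have maximal depth. -/

import Mathlib

open scoped TensorProduct

section MaximalDepth

variable {R : Type*} [CommRing R] (M : Type*) [AddCommGroup M] [Module R M]

/-- The depth of `M` with respect to the ideal `m`: the supremum of the lengths of the
`M`-regular sequences consisting of elements of `m`. For `m` the maximal ideal of a Noetherian
local ring, or the graded maximal ideal of a standard graded algebra, this is `depth M`. -/
noncomputable def moduleDepth (m : Ideal R) : ℕ∞ :=
  ⨆ (rs : List R) (_ : (∀ r ∈ rs, r ∈ m) ∧ RingTheory.Sequence.IsRegular M rs), (rs.length : ℕ∞)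

variable (R) in
/-- `mdepth M`: the minimum of `dim R/p` over the associated primes `p` of `M`. (The value set
lies in the well-ordered `WithBot ℕ∞`, so the infimum is attained as soon as `Ass M` is nonempty.) -/
noncomputable def moduleMdepth : WithBot ℕ∞ :=
  ⨅ p : associatedPrimes R M, ringKrullDim (R ⧸ (p : Ideal R))

/-- `M` has maximal depth (with respect to the distinguished maximal ideal `m` of `R`):
`depth M = mdepth M`. -/
def HasMaximalDepth (m : Ideal R) : Prop :=
  (moduleDepth M m : WithBot ℕ∞) = moduleMdepth R M

end MaximalDepth

section Graded

variable {K A : Type*} [Field K] [CommRing A] [Algebra K A]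

/-- An `ℕ`-graded `K`-algebra is standard graded if its degree-zero part is `K` (the image of the
structure map) and it is generated as a `K`-algebra by finitely many elements of degree one. -/
structure IsStandardGraded (𝒜 : ℕ → Submodule K A) [GradedAlgebra 𝒜] : Prop where
  degree_zero : 𝒜 0 = 1
  finite_degree_one : Module.Finite K (𝒜 1)
  generated : Algebra.adjoin K (𝒜 1 : Set A) = ⊤

/-- The ideal generated by the elements of positive degree; in a (nonzero) standard graded
algebra it is the graded maximal ideal. -/
def gradedMaximalIdeal (𝒜 : ℕ → Submodule K A) : Ideal A :=
  Ideal.span {a | ∃ n, 0 < n ∧ a ∈ 𝒜 n}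

/-- `ℳ` is a `ℤ`-grading of the module `M` over the `ℕ`-graded algebra `(A, 𝒜)`:
`M` is the internal direct sum of the `ℳ j`, and `A_i M_j ⊆ M_{i+j}`. -/
structure IsModuleGrading (𝒜 : ℕ → Submodule K A) {M : Type*} [AddCommGroup M] [Module K M]
    [Module A M] (ℳ : ℤ → Submodule K M) : Prop where
  isInternal : DirectSum.IsInternal ℳ
  smul_mem : ∀ (i : ℕ) (j : ℤ), ∀ a ∈ 𝒜 i, ∀ x ∈ ℳ j, a • x ∈ ℳ ((i : ℤ) + j)

/-- The total grading on `A ⊗ B`: the degree `n` part is the sum of the (images of)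
`A_i ⊗ B_j` with `i + j = n`. -/
def tensorGrading {B : Type*} [CommRing B] [Algebra K B]
    (𝒜 : ℕ → Submodule K A) (ℬ : ℕ → Submodule K B) (n : ℕ) : Submodule K (A ⊗[K] B) :=
  Submodule.span K {t | ∃ i j : ℕ, i + j = n ∧ ∃ a ∈ 𝒜 i, ∃ b ∈ ℬ j, t = a ⊗ₜ[K] b}

end Graded

section TensorModule

variable {K A B M N : Type*} [Field K] [CommRing A] [Algebra K A] [CommRing B] [Algebra K B]
  [AddCommGroup M] [Module K M] [Module A M] [IsScalarTower K A M]
  [AddCommGroup N] [Module K N] [Module B N] [IsScalarTower K B N]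

/-- The `A ⊗ B`-module structure on `M ⊗ N`, `(a ⊗ b) • (x ⊗ y) = (a • x) ⊗ (b • y)`. -/
noncomputable instance (priority := low) tensorTensorModule : Module (A ⊗[K] B) (M ⊗[K] N) :=
  Module.compHom (M ⊗[K] N)
    ((Module.endTensorEndAlgHom (R := K) (S := K) (A := K) (M := M) (N := N)).comp
      (Algebra.TensorProduct.map (Algebra.lsmul K K M) (Algebra.lsmul K K N))).toRingHom

theorem tensorTensorModule_smul_tmul (a : A) (b : B) (x : M) (y : N) :
    (a ⊗ₜ[K] b) • (x ⊗ₜ[K] y) = (a • x) ⊗ₜ[K] (b • y) :=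
  rfl

end TensorModule

/-!
The proof compares depth and mdepth separately: both are additive under `⊗`. Since
`depth M ≤ mdepth M` and `depth N ≤ mdepth N`, and all four numbers are finite, the sums agree if
and only if both pairs agree (`hasMaximalDepth_tensor_iff`).

*Depth.* A maximal `M`-regular sequence in an ideal `I` is recognized by a nonzero element of the
last quotient that is annihilated by `I`. All maximal regular sequences have the same length
(`HasMaximalRegularSequence.quotSMulTop`, `HasMaximalRegularSequence.moduleDepth_eq`). A maximal
sequence of `M` followed by one of `N` is `M ⊗ N`-regular because everything is flat over `K`, and
the tensor product of the two annihilated elements shows that it is maximal in `m ⊗ B + A ⊗ n`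
(`HasMaximalRegularSequence.tensor`). Depth is at most `dim A / p` for each associated prime `p`
below the maximal ideal (`exists_hasMaximalRegularSequence_le`), because an associated prime can be
enlarged whenever one reduces modulo a regular element.

*Mdepth.* Over an algebraically closed field `A / p ⊗ B / q` is a domain, by the Nullstellensatz
(`isDomain_tensorProduct_of_isAlgClosed`). So for associated primes `p` and `q` the kernel of
`A ⊗ B → A / p ⊗ B / q` is an associated prime of `M ⊗ N`. Conversely every associated prime of
`M ⊗ N` is contained in one of these kernels (`exists_le_tensorPrime`): by dévissage along
associated primes, an element outside of all of them is regular on `M ⊗ N`. Thus mdepth is additive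
as soon as `dim (A / p ⊗ B / q) = dim A / p + dim B / q`.

*Local rings.* If `A ⊗ B` is local, then `A` or `B` is algebraic over `K`
(`isAlgebraic_or_isAlgebraic_of_isLocalRing`). All quotients of that factor by primes are equal to
`K`, so the dimension formula is trivial and the maximal ideal is the expected one.

*Graded algebras.* The dimension formula follows from Noether normalization
(`ringKrullDim_tensorProduct_of_finiteType`). The rings are not local, but the associated primes of
a graded module lie below the graded maximal ideal (`IsStandardGraded.associatedPrimes_le`), which
is all that the argument needs.
-/

/-! ### Maximal regular sequences and depth -/

section Depth

open scoped Pointwise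

universe u v

variable {R : Type u} [CommRing R]

/-- `M` has a nonzero element annihilated by the ideal `I`. -/
def HasSocle (I : Ideal R) (M : Type v) [AddCommGroup M] [Module R M] : Prop :=
  ∃ u : M, u ≠ 0 ∧ ∀ i ∈ I, i • u = 0

/-- There is an `M`-regular sequence `x₁, …, xₙ` in `I` such that `M / (x₁, …, xₙ) M` has a
nonzero element annihilated by `I`; over a Noetherian ring this says that the sequence is a maximal
`M`-regular sequence in `I`. The definition is by recursion on the length. -/
def HasMaximalRegularSequence (I : Ideal R) :
    ℕ → ∀ (M : Type v) [AddCommGroup M] [Module R M], Prop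
  | 0, M, _, _ => HasSocle I M
  | n + 1, M, _, _ =>
    ∃ x ∈ I, IsSMulRegular M x ∧ HasMaximalRegularSequence I n (QuotSMulTop x M)

lemma HasSocle.of_injective {I : Ideal R} {M M' : Type*} [AddCommGroup M] [Module R M]
    [AddCommGroup M'] [Module R M'] (f : M →ₗ[R] M') (hf : Function.Injective f)
    (h : HasSocle I M) : HasSocle I M' := by
  obtain ⟨u, hu, h⟩ := h
  refine ⟨f u, (map_ne_zero_iff f hf).2 hu, fun i hi => ?_⟩
  rw [← map_smul, h i hi, map_zero]

lemma HasSocle.not_isSMulRegular {I : Ideal R} {M : Type*} [AddCommGroup M] [Module R M]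
    (h : HasSocle I M) {x : R} (hx : x ∈ I) : ¬ IsSMulRegular M x := by
  obtain ⟨u, hu, h⟩ := h
  exact fun hr => hu (hr.right_eq_zero_of_smul (h x hx))

lemma HasSocle.prod {I : Ideal R} {M M' : Type*} [AddCommGroup M] [Module R M]
    [AddCommGroup M'] [Module R M'] (h : HasSocle I (M × M')) : HasSocle I M ∨ HasSocle I M' := by
  obtain ⟨⟨u, v⟩, hu, h⟩ := h
  by_cases hu0 : u = 0
  · refine .inr ⟨v, fun hv => hu (by simp [hu0, hv]), fun i hi => congrArg Prod.snd (h i hi)⟩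
  · exact .inl ⟨u, hu0, fun i hi => congrArg Prod.fst (h i hi)⟩

lemma HasMaximalRegularSequence.congr {I : Ideal R} {n : ℕ} {M M' : Type*} [AddCommGroup M]
    [Module R M] [AddCommGroup M'] [Module R M'] (e : M ≃ₗ[R] M')
    (h : HasMaximalRegularSequence I n M) : HasMaximalRegularSequence I n M' := by
  induction n generalizing M M' with
  | zero => exact HasSocle.of_injective e.toLinearMap e.injective h
  | succ n ih =>
    obtain ⟨x, hx, hr, h⟩ := h
    exact ⟨x, hx, (e.isSMulRegular_congr x).1 hr, ih (QuotSMulTop.congr x e) h⟩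

/-- `(M / xM) / z(M / xM)` and `(M / zM) / x(M / zM)` are isomorphic. -/
noncomputable def QuotSMulTop.swap (x z : R) (M : Type v) [AddCommGroup M] [Module R M] :
    QuotSMulTop z (QuotSMulTop x M) ≃ₗ[R] QuotSMulTop x (QuotSMulTop z M) :=
  equivQuotTensor z _ ≪≫ₗ TensorProduct.congr (.refl R _) (equivQuotTensor x M) ≪≫ₗ
    TensorProduct.leftComm R _ _ _ ≪≫ₗ
    TensorProduct.congr (.refl R _) (equivQuotTensor z M).symm ≪≫ₗ (equivQuotTensor x _).symm

lemma mk_eq_zero_iff_exists_smul {M : Type*} [AddCommGroup M] [Module R M] {x : R} {m : M} :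
    (Submodule.Quotient.mk m : QuotSMulTop x M) = 0 ↔ ∃ m', m = x • m' := by
  rw [Submodule.Quotient.mk_eq_zero, Submodule.mem_smul_pointwise_iff_exists]
  simp [eq_comm]

lemma isSMulRegular_quotSMulTop_iff {M : Type*} [AddCommGroup M] [Module R M] {x z : R} :
    IsSMulRegular (QuotSMulTop x M) z ↔ ∀ m m' : M, z • m = x • m' → ∃ m'', m = x • m'' := by
  rw [isSMulRegular_iff_right_eq_zero_of_smul]
  constructor
  · intro h m m' hm
    refine mk_eq_zero_iff_exists_smul.1 (h _ ?_)
    rw [← Submodule.Quotient.mk_smul, mk_eq_zero_iff_exists_smul]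
    exact ⟨m', hm⟩
  · intro h m hm
    induction m using Submodule.Quotient.induction_on with | _ m
    rw [← Submodule.Quotient.mk_smul, mk_eq_zero_iff_exists_smul] at hm
    obtain ⟨m', hm⟩ := hm
    exact mk_eq_zero_iff_exists_smul.2 (h m m' hm)

lemma IsSMulRegular.quotSMulTop_comm {M : Type*} [AddCommGroup M] [Module R M] {x z : R}
    (hx : IsSMulRegular M x) (hxz : IsSMulRegular (QuotSMulTop x M) z) :
    IsSMulRegular (QuotSMulTop z M) x := by
  rw [isSMulRegular_quotSMulTop_iff] at hxz ⊢
  intro m m' h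
  obtain ⟨m'', rfl⟩ := hxz m' m h.symm
  exact ⟨m'', hx (by simpa [smul_comm z x] using h)⟩

/-- The case of length one of the invariance of the length of maximal regular sequences. -/
lemma HasSocle.quotSMulTop {I : Ideal R} {M : Type*} [AddCommGroup M] [Module R M] {x y : R}
    (hx : IsSMulRegular M x) (hy : IsSMulRegular M y) (hyI : y ∈ I)
    (h : HasSocle I (QuotSMulTop x M)) : HasSocle I (QuotSMulTop y M) := by
  obtain ⟨u, hu, h⟩ := h
  induction u using Submodule.Quotient.induction_on with | _ u
  have key : ∀ i ∈ I, ∃ w, i • u = x • w := fun i hi => by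
    have := h i hi
    rwa [← Submodule.Quotient.mk_smul, mk_eq_zero_iff_exists_smul] at this
  rw [Ne, mk_eq_zero_iff_exists_smul] at hu
  obtain ⟨v, hv⟩ := key y hyI
  refine ⟨Submodule.Quotient.mk v, ?_, fun i hi => ?_⟩
  · rw [Ne, mk_eq_zero_iff_exists_smul]
    rintro ⟨w, rfl⟩
    exact hu ⟨w, hy (by simpa [smul_comm x y] using hv)⟩
  · rw [← Submodule.Quotient.mk_smul, mk_eq_zero_iff_exists_smul]
    obtain ⟨w, hw⟩ := key i hi
    refine ⟨w, hx ?_⟩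
    change x • i • v = x • y • w
    rw [smul_comm x i, ← hv, smul_comm i y, hw, smul_comm x y]

lemma HasMaximalRegularSequence.exists_isRegular {I : Ideal R} {n : ℕ} {M : Type*}
    [AddCommGroup M] [Module R M] (h : HasMaximalRegularSequence I n M) :
    ∃ rs : List R, (∀ r ∈ rs, r ∈ I) ∧ RingTheory.Sequence.IsRegular M rs ∧ rs.length = n := by
  induction n generalizing M with
  | zero =>
    obtain ⟨u, hu, -⟩ := h
    have : Nontrivial M := ⟨u, 0, hu⟩
    exact ⟨[], by simp, .nil R M, rfl⟩
  | succ n ih =>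
    obtain ⟨x, hx, hxr, h⟩ := h
    obtain ⟨rs, hrs, hr, rfl⟩ := ih h
    exact ⟨x :: rs, by simpa [hx] using hrs,
      (RingTheory.Sequence.isRegular_cons_iff M x rs).2 ⟨hxr, hr⟩, rfl⟩

variable [IsNoetherianRing R]

lemma exists_isSMulRegular_or_hasSocle (I : Ideal R) (M : Type*) [AddCommGroup M] [Module R M]
    [Module.Finite R M] : (∃ z ∈ I, IsSMulRegular M z) ∨ HasSocle I M := by
  by_contra! hcon
  obtain ⟨h1, h2⟩ := hcon
  have hsub : (I : Set R) ⊆ ⋃ p ∈ associatedPrimes R M, (p : Set R) := by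
    intro z hz
    rw [biUnion_associatedPrimes_eq_zero_divisors R M]
    have := h1 z hz
    rw [isSMulRegular_iff_right_eq_zero_of_smul] at this
    push Not at this
    obtain ⟨u, hu, hne⟩ := this
    exact ⟨u, hne, hu⟩
  obtain ⟨p, hp, hIp⟩ := (I.subset_union_prime_finite (associatedPrimes.finite R M) (f := id) 0 0
    fun _ h _ _ => h.isPrime).1 hsub
  obtain ⟨hp, u, rfl⟩ := isAssociatedPrime_iff.1 (show IsAssociatedPrime p M from hp)
  refine h2 ⟨u, ?_, fun i hi => by simpa using hIp hi⟩
  rintro rfl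
  exact hp.ne_top (by simp)

/-- Reducing modulo an arbitrary regular element of `I` lowers the length of maximal regular
sequences in `I` by one. An element regular on `M / xM` and on `M / yM` allows to pass from
`y` to `x`. -/
lemma HasMaximalRegularSequence.quotSMulTop {I : Ideal R} {n : ℕ} {M : Type*} [AddCommGroup M]
    [Module R M] [Module.Finite R M] (h : HasMaximalRegularSequence I n M) {x : R} (hx : x ∈ I)
    (hxr : IsSMulRegular M x) :
    ∃ k, n = k + 1 ∧ HasMaximalRegularSequence I k (QuotSMulTop x M) := by
  induction n generalizing M x with
  | zero => exact (HasSocle.not_isSMulRegular h hx hxr).elim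
  | succ n ih =>
    refine ⟨n, rfl, ?_⟩
    obtain ⟨y, hy, hyr, h⟩ := h
    cases n with
    | zero => exact HasSocle.quotSMulTop hyr hxr hx h
    | succ n =>
      obtain ⟨y', hy', hyr', -⟩ := id h
      have hMy : ¬ HasSocle I (QuotSMulTop y M) := fun hs => hs.not_isSMulRegular hy' hyr'
      have hMx : ¬ HasSocle I (QuotSMulTop x M) := fun hs => hMy (hs.quotSMulTop hxr hyr hy)
      obtain ⟨z, hz, hzr⟩ : ∃ z ∈ I, IsSMulRegular (QuotSMulTop x M × QuotSMulTop y M) z :=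
        (exists_isSMulRegular_or_hasSocle I _).resolve_right fun hs => hs.prod.elim hMx hMy
      have hzx : IsSMulRegular (QuotSMulTop x M) z :=
        hzr.of_injective (LinearMap.inl R _ (QuotSMulTop y M)) LinearMap.inl_injective
      have hzy : IsSMulRegular (QuotSMulTop y M) z :=
        hzr.of_injective (LinearMap.inr R (QuotSMulTop x M) _) LinearMap.inr_injective
      -- From `M / yM` to `M / (y, z)M`, back to `M / zM`, on to `M / (z, x)M`, back to `M / xM`.
      obtain ⟨k, hk, h1⟩ := ih h hz hzy
      obtain rfl : n = k := by omega
      have h2 : HasMaximalRegularSequence I (n + 1) (QuotSMulTop z M) :=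
        ⟨y, hy, hyr.quotSMulTop_comm hzy, h1.congr (QuotSMulTop.swap y z M)⟩
      obtain ⟨k, hk, h3⟩ := ih h2 hx (hxr.quotSMulTop_comm hzx)
      obtain rfl : n = k := by omega
      exact ⟨z, hz, hzx, h3.congr (QuotSMulTop.swap z x M)⟩

lemma HasMaximalRegularSequence.length_le {I : Ideal R} {n : ℕ} {M : Type*} [AddCommGroup M]
    [Module R M] [Module.Finite R M] (h : HasMaximalRegularSequence I n M) {rs : List R}
    (hrs : ∀ r ∈ rs, r ∈ I) (hr : RingTheory.Sequence.IsRegular M rs) : rs.length ≤ n := by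
  induction rs generalizing n M with
  | nil => simp
  | cons r rs ih =>
    rw [RingTheory.Sequence.isRegular_cons_iff] at hr
    obtain ⟨k, rfl, hk⟩ := h.quotSMulTop (hrs r (by simp)) hr.1
    simpa using ih hk (fun s hs => hrs s (by simp [hs])) hr.2

/-- All maximal regular sequences in `I` have the same length, the depth. -/
lemma HasMaximalRegularSequence.moduleDepth_eq {I : Ideal R} {n : ℕ} {M : Type*}
    [AddCommGroup M] [Module R M] [Module.Finite R M] (h : HasMaximalRegularSequence I n M) :
    moduleDepth M I = n := by
  refine le_antisymm (iSup₂_le fun rs hrs => ?_) ?_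
  · exact_mod_cast h.length_le hrs.1 hrs.2
  · obtain ⟨rs, h1, h2, rfl⟩ := h.exists_isRegular
    exact le_iSup₂_of_le rs ⟨h1, h2⟩ le_rfl

end Depth

/-! ### Depth is bounded by the dimension of associated primes -/

section DepthLeDim

universe u v

variable {R : Type u} [CommRing R]

/-- A determinant trick: if `s W ⊆ x W`, then a power of `s` acts on `W` as a multiple of `x`. -/
lemma exists_pow_sub_mem_and_smul_eq_zero {W : Type*} [AddCommGroup W] [Module R W]
    [Module.Finite R W] {s x : R} (h : ∀ w : W, ∃ w', s • w = x • w') :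
    ∃ (n : ℕ) (r : R), s ^ n - r ∈ Ideal.span {x} ∧ ∀ w : W, r • w = 0 := by
  obtain ⟨f, hf, -, hcoeff, h0⟩ :=
    LinearMap.exists_monic_and_natDegree_eq_and_coeff_mem_pow_and_aeval_eq_zero
      R (algebraMap R (Module.End R W) s) (Ideal.span {x}) (by
      rintro _ ⟨w, rfl⟩
      obtain ⟨w', hw⟩ := h w
      rw [Module.algebraMap_end_apply, hw]
      exact Submodule.smul_mem_smul (Ideal.mem_span_singleton_self x) trivial)
  refine ⟨f.natDegree, f.eval s, ?_, fun w => ?_⟩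
  · rw [Polynomial.eval_eq_sum_range, Finset.sum_range_succ, hf.coeff_natDegree, one_mul,
      sub_add_cancel_right]
    refine neg_mem (Ideal.sum_mem _ fun k hk => Ideal.mul_mem_right _ _ ?_)
    have hk := Finset.mem_range.1 hk
    exact Ideal.pow_le_self (by omega) (hcoeff k)
  · have := congrArg (fun g : Module.End R W => g w) h0
    rwa [Polynomial.aeval_algebraMap_apply, Polynomial.coe_aeval_eq_eval] at this

lemma ringKrullDim_quotient_succ_le_of_lt {p q : Ideal R} [p.IsPrime] (h : p < q) :
    ringKrullDim (R ⧸ q) + 1 ≤ ringKrullDim (R ⧸ p) := by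
  obtain ⟨x, hxq, hxp⟩ := SetLike.exists_of_lt h
  refine ringKrullDim_succ_le_of_surjective (Ideal.Quotient.factor h.le)
    (Ideal.Quotient.factor_surjective h.le) (r := Ideal.Quotient.mk p x) ?_ ?_
  · exact mem_nonZeroDivisors_of_ne_zero (by rwa [Ne, Ideal.Quotient.eq_zero_iff_mem])
  · simpa [Ideal.Quotient.eq_zero_iff_mem] using hxq

variable [IsNoetherianRing R]

/-- Reducing modulo a regular element `x ∈ m` enlarges associated primes below `m`: apply the
determinant trick to the elements of `M` annihilated by `p`, whose reduction modulo `x` embeds into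
`M / xM`. -/
lemma exists_associatedPrimes_quotSMulTop {M : Type*} [AddCommGroup M] [Module R M]
    [Module.Finite R M] {m p : Ideal R} [m.IsPrime] (hp : p ∈ associatedPrimes R M) (hpm : p ≤ m)
    {x : R} (hx : x ∈ m) (hxr : IsSMulRegular M x) :
    ∃ q ∈ associatedPrimes R (QuotSMulTop x M), p ≤ q ∧ x ∈ q ∧ q ≤ m := by
  obtain ⟨hpp, u, hu⟩ := isAssociatedPrime_iff.1 (show IsAssociatedPrime p M from hp)
  let W : Submodule R M := Submodule.torsionBySet R M p
  have hW : ∀ {w : M}, w ∈ W ↔ ∀ a ∈ p, a • w = 0 := by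
    intro w; simp [W, Submodule.mem_torsionBySet_iff]
  have huW : u ∈ W := hW.2 fun a ha => by simpa [hu] using ha
  -- Some element of `W` has a class in `M / xM` whose annihilator lies in `m`. Otherwise a single
  -- `s ∉ m` maps `W` into `xM ∩ W = xW`, and the determinant trick gives `s ^ n ∈ m`.
  obtain ⟨w, hwW, hw⟩ : ∃ w ∈ W, ∀ s : R, (∃ w', s • w = x • w') → s ∈ m := by
    by_contra! hcon
    obtain ⟨t, ht⟩ : W.FG := IsNoetherian.noetherian W
    have : ∃ s ∉ m, ∀ w ∈ W, ∃ w', s • w = x • w' := by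
      have htW : ∀ w ∈ t, w ∈ W := fun w hw => ht ▸ Submodule.subset_span hw
      have hch : ∀ w ∈ t, ∃ s : R, (∃ w', s • w = x • w') ∧ s ∉ m := fun w hw =>
        hcon w (htW w hw)
      choose! s hs hsm using hch
      refine ⟨∏ w ∈ t, s w, fun h => ?_, fun w hw => ?_⟩
      · obtain ⟨w, hw, hwm⟩ := (Ideal.IsPrime.prod_mem_iff).1 h
        exact hsm w hw hwm
      · rw [← ht] at hw
        induction hw using Submodule.span_induction with
        | mem w hw =>
          obtain ⟨w', hw'⟩ := hs w hw
          classical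
          refine ⟨(∏ v ∈ t.erase w, s v) • w', ?_⟩
          rw [← Finset.prod_erase_mul _ _ hw, mul_smul, hw', smul_comm]
        | zero => exact ⟨0, by simp⟩
        | add a b _ _ ha hb =>
          obtain ⟨a', ha⟩ := ha
          obtain ⟨b', hb⟩ := hb
          exact ⟨a' + b', by rw [smul_add, ha, hb, smul_add]⟩
        | smul r a _ ha =>
          obtain ⟨a', ha⟩ := ha
          exact ⟨r • a', by rw [smul_comm, ha, smul_comm]⟩
    obtain ⟨s, hsm, hs⟩ := this
    obtain ⟨n, r, hr, hr0⟩ := exists_pow_sub_mem_and_smul_eq_zero (W := W) (s := s) (x := x) (by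
      rintro ⟨w, hw⟩
      obtain ⟨w', hw'⟩ := hs w hw
      refine ⟨⟨w', hW.2 fun a ha => hxr ?_⟩, Subtype.ext hw'⟩
      change x • a • w' = x • (0 : M)
      rw [smul_comm, ← hw', smul_comm, hW.1 hw a ha, smul_zero, smul_zero])
    -- `r` annihilates `u`, whose annihilator is `p`.
    have hrp : r ∈ p := by
      have := congrArg Subtype.val (hr0 ⟨u, huW⟩)
      simpa [hu] using this
    have : s ^ n ∈ m := by
      have h1 := (Ideal.span_singleton_le_iff_mem m).2 hx hr
      simpa using m.add_mem h1 (hpm hrp)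
    exact hsm (Ideal.IsPrime.mem_of_pow_mem ‹_› n this)
  have hcol : ∀ s : R, s ∈ (⊥ : Submodule R (QuotSMulTop x M)).colon
      {Submodule.Quotient.mk w} ↔ ∃ w', s • w = x • w' := fun s => by
    rw [Submodule.mem_colon_singleton, Submodule.mem_bot, ← Submodule.Quotient.mk_smul,
      mk_eq_zero_iff_exists_smul]
  obtain ⟨q, hq, hqm⟩ := Ideal.exists_minimalPrimes_le
    (show (⊥ : Submodule R (QuotSMulTop x M)).colon {Submodule.Quotient.mk w} ≤ m from
      fun s hs => hw s ((hcol s).1 hs))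
  refine ⟨q, isAssociatedPrime_iff.2 ⟨hq.1.1, Submodule.exists_eq_colon_of_mem_minimalPrimes hq⟩,
    fun a ha => hq.1.2 ((hcol a).2 ⟨0, ?_⟩), hq.1.2 ((hcol x).2 ⟨w, rfl⟩), hqm⟩
  rw [hW.1 hwW a ha, smul_zero]

/-- If `p ≤ m` is an associated prime of `M` with `dim R / p` finite, then there is a maximal
regular sequence in `m`, and its length is at most `dim R / p`. -/
lemma exists_hasMaximalRegularSequence_le {M : Type v} [AddCommGroup M] [Module R M]
    [Module.Finite R M] {m p : Ideal R} [m.IsPrime] (hp : p ∈ associatedPrimes R M) (hpm : p ≤ m)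
    (hdim : ringKrullDim (R ⧸ p) < ⊤) :
    ∃ n : ℕ, HasMaximalRegularSequence m n M ∧ (n : WithBot ℕ∞) ≤ ringKrullDim (R ⧸ p) := by
  obtain ⟨d, hd⟩ : ∃ d : ℕ, ringKrullDim (R ⧸ p) < d := by
    generalize ringKrullDim (R ⧸ p) = e at hdim
    induction e with
    | bot => exact ⟨0, WithBot.bot_lt_coe _⟩
    | coe e =>
      induction e with
      | top => exact absurd hdim (by simp)
      | coe e => exact ⟨e + 1, by exact_mod_cast Nat.lt_succ_self e⟩
  clear hdim
  induction d generalizing M p with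
  | zero =>
    have : p.IsPrime := IsAssociatedPrime.isPrime hp
    exact absurd hd (not_lt.2 (by simpa using ringKrullDim_nonneg_of_nontrivial))
  | succ d ih =>
    have : p.IsPrime := IsAssociatedPrime.isPrime hp
    rcases exists_isSMulRegular_or_hasSocle m M with ⟨x, hx, hxr⟩ | hs
    · obtain ⟨q, hq, hpq, hxq, hqm⟩ := exists_associatedPrimes_quotSMulTop hp hpm hx hxr
      have hxp : x ∉ p := by
        intro hxp
        obtain ⟨hp', u, rfl⟩ := isAssociatedPrime_iff.1 (show IsAssociatedPrime p M from hp)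
        have hu := hxr.right_eq_zero_of_smul (Submodule.mem_colon_singleton.1 hxp)
        exact hp'.ne_top (by simp [hu])
      have hle := ringKrullDim_quotient_succ_le_of_lt
        (lt_of_le_of_ne hpq fun h => hxp (h ▸ hxq))
      obtain ⟨n, hn, hnq⟩ := ih hq hqm (by
        have := hle.trans_lt hd
        push_cast at this
        exact lt_of_add_lt_add_right this)
      refine ⟨n + 1, ⟨x, hx, hxr, hn⟩, le_trans ?_ hle⟩
      push_cast
      gcongr
    · exact ⟨0, hs, by simpa using ringKrullDim_nonneg_of_nontrivial⟩

end DepthLeDim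

/-! ### Tensor products of modules over `A ⊗ B` -/

section TensorModules

open scoped Pointwise

universe u v

variable {K A B M M' N N' : Type*} [Field K] [CommRing A] [Algebra K A] [CommRing B] [Algebra K B]
  [AddCommGroup M] [Module K M] [Module A M] [IsScalarTower K A M]
  [AddCommGroup M'] [Module K M'] [Module A M'] [IsScalarTower K A M']
  [AddCommGroup N] [Module K N] [Module B N] [IsScalarTower K B N]
  [AddCommGroup N'] [Module K N'] [Module B N'] [IsScalarTower K B N']

/-- The tensor product over `K` of an `A`-linear and a `B`-linear map, as an `A ⊗ B`-linear map. -/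
noncomputable def tensorMap (g : M →ₗ[A] M') (h : N →ₗ[B] N') :
    (M ⊗[K] N) →ₗ[A ⊗[K] B] (M' ⊗[K] N') where
  toFun := TensorProduct.map (g.restrictScalars K) (h.restrictScalars K)
  map_add' := map_add _
  map_smul' r t := by
    induction r with
    | zero => simp
    | add r s hr hs => rw [add_smul, map_add, hr, hs, RingHom.id_apply, RingHom.id_apply,
        RingHom.id_apply, add_smul]
    | tmul a b =>
      induction t with
      | zero => simp
      | add s t hs ht => rw [smul_add, map_add, hs, ht, map_add, smul_add]
      | tmul x y => simp [tensorTensorModule_smul_tmul]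

@[simp]
lemma tensorMap_tmul (g : M →ₗ[A] M') (h : N →ₗ[B] N') (x : M) (y : N) :
    tensorMap (K := K) g h (x ⊗ₜ y) = g x ⊗ₜ h y := rfl

lemma tensorMap_injective {g : M →ₗ[A] M'} {h : N →ₗ[B] N'} (hg : Function.Injective g)
    (hh : Function.Injective h) : Function.Injective (tensorMap (K := K) g h) :=
  TensorProduct.map_injective_of_flat_flat _ _ hg hh

lemma tensorMap_surjective {g : M →ₗ[A] M'} {h : N →ₗ[B] N'} (hg : Function.Surjective g)
    (hh : Function.Surjective h) : Function.Surjective (tensorMap (K := K) g h) :=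
  TensorProduct.map_surjective (g := g.restrictScalars K) (g' := h.restrictScalars K) hg hh

lemma tensorMap_id_exact {M'' : Type*} [AddCommGroup M''] [Module K M''] [Module A M'']
    [IsScalarTower K A M''] {f : M →ₗ[A] M'} {g : M' →ₗ[A] M''} (hfg : Function.Exact f g)
    (hg : Function.Surjective g) :
    Function.Exact (tensorMap (K := K) f (.id : N →ₗ[B] N))
      (tensorMap (K := K) g (.id : N →ₗ[B] N)) :=
  rTensor_exact (f := f.restrictScalars K) (g := g.restrictScalars K) N hfg hg

lemma id_tensorMap_exact {N'' : Type*} [AddCommGroup N''] [Module K N''] [Module B N'']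
    [IsScalarTower K B N''] {f : N →ₗ[B] N'} {g : N' →ₗ[B] N''} (hfg : Function.Exact f g)
    (hg : Function.Surjective g) :
    Function.Exact (tensorMap (K := K) (.id : M →ₗ[A] M) f)
      (tensorMap (K := K) (.id : M →ₗ[A] M) g) :=
  lTensor_exact (f := f.restrictScalars K) (g := g.restrictScalars K) M hfg hg

lemma tmul_one_smul (a : A) (t : M ⊗[K] N) :
    (a ⊗ₜ[K] (1 : B)) • t = tensorMap (K := K) (LinearMap.lsmul A M a) (.id : N →ₗ[B] N) t := by
  induction t with
  | zero => simp
  | add s t hs ht => rw [smul_add, map_add, hs, ht]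
  | tmul x y => simp [tensorTensorModule_smul_tmul]

lemma one_tmul_smul (b : B) (t : M ⊗[K] N) :
    ((1 : A) ⊗ₜ[K] b) • t = tensorMap (K := K) (.id : M →ₗ[A] M) (LinearMap.lsmul B N b) t := by
  induction t with
  | zero => simp
  | add s t hs ht => rw [smul_add, map_add, hs, ht]
  | tmul x y => simp [tensorTensorModule_smul_tmul]

lemma exact_lsmul_mkQ (a : A) :
    Function.Exact (LinearMap.lsmul A M a) (a • (⊤ : Submodule A M)).mkQ := by
  intro m
  rw [Submodule.mkQ_apply, mk_eq_zero_iff_exists_smul]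
  simp [eq_comm]

lemma smul_top_eq_ker_tensorMap_mkQ_id (a : A) :
    (a ⊗ₜ[K] (1 : B)) • (⊤ : Submodule (A ⊗[K] B) (M ⊗[K] N)) =
      LinearMap.ker (tensorMap (K := K) (a • (⊤ : Submodule A M)).mkQ (.id : N →ₗ[B] N)) := by
  ext t
  rw [LinearMap.mem_ker, tensorMap_id_exact (exact_lsmul_mkQ a) (Submodule.mkQ_surjective _) t,
    Submodule.mem_smul_pointwise_iff_exists]
  simp [tmul_one_smul]

lemma smul_top_eq_ker_id_tensorMap_mkQ (b : B) :
    ((1 : A) ⊗ₜ[K] b) • (⊤ : Submodule (A ⊗[K] B) (M ⊗[K] N)) =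
      LinearMap.ker (tensorMap (K := K) (.id : M →ₗ[A] M) (b • (⊤ : Submodule B N)).mkQ) := by
  ext t
  rw [LinearMap.mem_ker, id_tensorMap_exact (exact_lsmul_mkQ b) (Submodule.mkQ_surjective _) t,
    Submodule.mem_smul_pointwise_iff_exists]
  simp [one_tmul_smul]

variable (K A B M N) in
/-- Reduction modulo `a ⊗ 1`: `(M ⊗ N) / (a ⊗ 1)` is `(M / aM) ⊗ N`. -/
noncomputable def quotSMulTopTmulOneEquiv (a : A) :
    QuotSMulTop (a ⊗ₜ[K] (1 : B)) (M ⊗[K] N) ≃ₗ[A ⊗[K] B] (QuotSMulTop a M ⊗[K] N) :=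
  (Submodule.quotEquivOfEq _ _ (smul_top_eq_ker_tensorMap_mkQ_id a)).trans
    (LinearMap.quotKerEquivOfSurjective _
      (tensorMap_surjective (Submodule.mkQ_surjective _) Function.surjective_id))

variable (K A B M N) in
/-- Reduction modulo `1 ⊗ b`: `(M ⊗ N) / (1 ⊗ b)` is `M ⊗ (N / bN)`. -/
noncomputable def quotSMulTopOneTmulEquiv (b : B) :
    QuotSMulTop ((1 : A) ⊗ₜ[K] b) (M ⊗[K] N) ≃ₗ[A ⊗[K] B] (M ⊗[K] QuotSMulTop b N) :=
  (Submodule.quotEquivOfEq _ _ (smul_top_eq_ker_id_tensorMap_mkQ b)).trans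
    (LinearMap.quotKerEquivOfSurjective _
      (tensorMap_surjective Function.surjective_id (Submodule.mkQ_surjective _)))

lemma IsSMulRegular.tmul_one {a : A} (h : IsSMulRegular M a) :
    IsSMulRegular (M ⊗[K] N) (a ⊗ₜ[K] (1 : B)) := by
  have := tensorMap_injective (K := K) (g := LinearMap.lsmul A M a) (h := (.id : N →ₗ[B] N)) h
    Function.injective_id
  intro s t hst
  exact this (by simpa only [tmul_one_smul] using hst)

lemma IsSMulRegular.one_tmul {b : B} (h : IsSMulRegular N b) :
    IsSMulRegular (M ⊗[K] N) ((1 : A) ⊗ₜ[K] b) := by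
  have := tensorMap_injective (K := K) (g := (.id : M →ₗ[A] M)) (h := LinearMap.lsmul B N b)
    Function.injective_id h
  intro s t hst
  exact this (by simpa only [one_tmul_smul] using hst)

lemma tmul_ne_zero_of_field {x : M} {y : N} (hx : x ≠ 0) (hy : y ≠ 0) : x ⊗ₜ[K] y ≠ 0 := by
  have h := TensorProduct.map_injective_of_flat_flat (LinearMap.toSpanSingleton K M x)
    (LinearMap.toSpanSingleton K N y) (smul_left_injective K hx) (smul_left_injective K hy)
  intro h0
  have h1 : (1 : K) ⊗ₜ[K] (1 : K) = 0 := h (by simpa using h0)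
  simpa using congrArg (TensorProduct.lid K K) h1

/-- The ideal `I ⊗ B + A ⊗ J` of `A ⊗ B`. -/
def tensorIdeal (K : Type*) {A B : Type*} [Field K] [CommRing A] [Algebra K A] [CommRing B]
    [Algebra K B] (I : Ideal A) (J : Ideal B) : Ideal (A ⊗[K] B) :=
  I.map (Algebra.TensorProduct.includeLeft : A →ₐ[K] A ⊗[K] B) ⊔
    J.map (Algebra.TensorProduct.includeRight : B →ₐ[K] A ⊗[K] B)

lemma tmul_one_mem_tensorIdeal {I : Ideal A} (J : Ideal B) {a : A} (ha : a ∈ I) :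
    a ⊗ₜ[K] (1 : B) ∈ tensorIdeal K I J :=
  Ideal.mem_sup_left
    (Ideal.mem_map_of_mem (Algebra.TensorProduct.includeLeft : A →ₐ[K] A ⊗[K] B) ha)

lemma one_tmul_mem_tensorIdeal (I : Ideal A) {J : Ideal B} {b : B} (hb : b ∈ J) :
    (1 : A) ⊗ₜ[K] b ∈ tensorIdeal K I J :=
  Ideal.mem_sup_right
    (Ideal.mem_map_of_mem (Algebra.TensorProduct.includeRight : B →ₐ[K] A ⊗[K] B) hb)

lemma tensorIdeal_le {I : Ideal A} {J : Ideal B} {Q : Ideal (A ⊗[K] B)}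
    (hI : ∀ a ∈ I, a ⊗ₜ[K] (1 : B) ∈ Q) (hJ : ∀ b ∈ J, (1 : A) ⊗ₜ[K] b ∈ Q) :
    tensorIdeal K I J ≤ Q :=
  sup_le (Ideal.map_le_iff_le_comap.2 hI) (Ideal.map_le_iff_le_comap.2 hJ)

lemma HasSocle.tensor {I : Ideal A} {J : Ideal B} (hM : HasSocle I M) (hN : HasSocle J N) :
    HasSocle (tensorIdeal K I J) (M ⊗[K] N) := by
  obtain ⟨x, hx, hIx⟩ := hM
  obtain ⟨y, hy, hJy⟩ := hN
  refine ⟨x ⊗ₜ y, tmul_ne_zero_of_field hx hy, fun r hr => ?_⟩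
  have : tensorIdeal K I J ≤ LinearMap.ker (LinearMap.toSpanSingleton (A ⊗[K] B) _ (x ⊗ₜ[K] y)) :=
    tensorIdeal_le (fun a ha => by simp [tensorTensorModule_smul_tmul, hIx a ha])
      (fun b hb => by simp [tensorTensorModule_smul_tmul, hJy b hb])
  simpa using this hr

/-- A maximal regular sequence of `M` followed by one of `N` is a maximal regular sequence of
`M ⊗ N`. -/
lemma HasMaximalRegularSequence.tensor {M : Type u} {N : Type v} [AddCommGroup M] [Module K M]
    [Module A M] [IsScalarTower K A M] [AddCommGroup N] [Module K N] [Module B N]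
    [IsScalarTower K B N] {I : Ideal A} {J : Ideal B} {m n : ℕ}
    (hM : HasMaximalRegularSequence I m M) (hN : HasMaximalRegularSequence J n N) :
    HasMaximalRegularSequence (tensorIdeal K I J) (m + n) (M ⊗[K] N) := by
  induction m generalizing M with
  | zero =>
    rw [zero_add]
    induction n generalizing N with
    | zero => exact HasSocle.tensor hM hN
    | succ n ih =>
      obtain ⟨y, hy, hyr, hN⟩ := hN
      exact ⟨_, one_tmul_mem_tensorIdeal I hy, hyr.one_tmul,
        (ih hN).congr (quotSMulTopOneTmulEquiv K A B M N y).symm⟩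
  | succ m ih =>
    obtain ⟨x, hx, hxr, hM⟩ := hM
    rw [add_right_comm]
    exact ⟨_, tmul_one_mem_tensorIdeal J hx, hxr.tmul_one,
        (ih hM).congr (quotSMulTopTmulOneEquiv K A B M N x).symm⟩

variable (K A B M N) in
lemma finite_tensor [Module.Finite A M] [Module.Finite B N] :
    Module.Finite (A ⊗[K] B) (M ⊗[K] N) := by
  obtain ⟨s, hs⟩ := Module.Finite.fg_top (R := A) (M := M)
  obtain ⟨t, ht⟩ := Module.Finite.fg_top (R := B) (M := N)
  classical
  refine ⟨⟨(s ×ˢ t).image fun z => z.1 ⊗ₜ[K] z.2, ?_⟩⟩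
  rw [eq_top_iff]
  rintro z -
  set P := Submodule.span (A ⊗[K] B)
    (((s ×ˢ t).image fun z => z.1 ⊗ₜ[K] z.2 : Finset (M ⊗[K] N)) : Set (M ⊗[K] N)) with hP
  have h1 : ∀ x ∈ s, ∀ y : N, x ⊗ₜ[K] y ∈ P := by
    intro x hx y
    have hy : y ∈ Submodule.span B (t : Set N) := ht ▸ trivial
    induction hy using Submodule.span_induction with
    | mem y hy => 
      exact Submodule.subset_span (Finset.mem_coe.2 (Finset.mem_image.2
        ⟨(x, y), Finset.mem_product.2 ⟨hx, hy⟩, rfl⟩))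
    | zero => simp
    | add y z _ _ hy hz => rw [TensorProduct.tmul_add]; exact P.add_mem hy hz
    | smul b y _ hy =>
      have := P.smul_mem ((1 : A) ⊗ₜ[K] b) hy
      rwa [tensorTensorModule_smul_tmul, one_smul] at this
  have h2 : ∀ (x : M) (y : N), x ⊗ₜ[K] y ∈ P := by
    intro x y
    have hx : x ∈ Submodule.span A (s : Set M) := hs ▸ trivial
    induction hx using Submodule.span_induction with
    | mem x hx => exact h1 x hx y
    | zero => simp
    | add y z _ _ hy hz => rw [TensorProduct.add_tmul]; exact P.add_mem hy hz
    | smul a x _ hx =>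
      have := P.smul_mem (a ⊗ₜ[K] (1 : B)) hx
      rwa [tensorTensorModule_smul_tmul, one_smul] at this
  induction z with
  | zero => exact P.zero_mem
  | add y z hy hz => exact P.add_mem hy hz
  | tmul x y => exact h2 x y

end TensorModules

/-! ### Tensor products of domains over an algebraically closed field -/

section Domain

variable {K D D' : Type*} [Field K] [IsAlgClosed K] [CommRing D] [Algebra K D] [CommRing D']
  [Algebra K D']

/-- A maximal ideal of a finitely generated algebra over an algebraically closed field is the kernel
of a point with values in the field. -/
lemma exists_algHom_ker_eq_of_isMaximal [Algebra.FiniteType K D] (n : Ideal D) [n.IsMaximal] :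
    ∃ φ : D →ₐ[K] K, RingHom.ker φ = n := by
  let := Ideal.Quotient.field n
  have : Module.Finite K (D ⧸ n) := finite_of_finite_type_of_isJacobsonRing K (D ⧸ n)
  let e : K ≃ₐ[K] (D ⧸ n) :=
    .ofBijective (Algebra.ofId K _) IsAlgClosed.algebraMap_bijective_of_isIntegral
  refine ⟨e.symm.toAlgHom.comp (Ideal.Quotient.mkₐ K n), ?_⟩
  ext a
  rw [RingHom.mem_ker]
  change e.symm (Ideal.Quotient.mk n a) = 0 ↔ _
  rw [EmbeddingLike.map_eq_zero_iff, Ideal.Quotient.eq_zero_iff_mem]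

variable [IsDomain D] [IsDomain D']

/-- If `f g = 0` in `D ⊗ D'`, then at each point of `D` the specialization of `f` or of `g` to `D'`
vanishes. So products of coordinates of `f` and `g` vanish at all points of `D`, and hence are
zero. -/
lemma noZeroDivisors_tensorProduct_of_finiteType [Algebra.FiniteType K D] :
    NoZeroDivisors (D ⊗[K] D') := by
  refine ⟨fun {f g} hfg => ?_⟩
  let b := Module.Free.chooseBasis K D'
  let c := Algebra.TensorProduct.basis D b
  have hpt : ∀ i j, c.repr f i * c.repr g j = 0 := by
    intro i j
    have hjac : c.repr f i * c.repr g j ∈ (⊥ : Ideal D).jacobson := by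
      rw [Ideal.jacobson, Submodule.mem_sInf]
      rintro n ⟨-, hn⟩
      obtain ⟨φ, rfl⟩ := exists_algHom_ker_eq_of_isMaximal (K := K) n
      let ψ : D ⊗[K] D' →ₐ[K] D' :=
        Algebra.TensorProduct.lift ((Algebra.ofId K D').comp φ) (.id K D') fun _ _ => .all _ _
      have hψ : ∀ t i, b.repr (ψ t) i = φ (c.repr t i) := by
        intro t i
        induction t with
        | zero => simp
        | add s t hs ht => simp [hs, ht]
        | tmul d d' =>
          have : ψ (d ⊗ₜ d') = φ d • d' := by
            simp [ψ, Algebra.smul_def, Algebra.ofId_apply]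
          rw [this]
          simp [c, Algebra.TensorProduct.basis_repr_tmul]
      have h0 : ψ f * ψ g = 0 := by rw [← map_mul, hfg, map_zero]
      rw [RingHom.mem_ker, map_mul]
      change φ _ * φ _ = 0
      rw [← hψ, ← hψ]
      rcases mul_eq_zero.1 h0 with h | h <;> simp [h]
    have hJ : IsJacobsonRing D := isJacobsonRing_of_finiteType (A := K)
    rwa [hJ.out (Ideal.isRadical_bot)] at hjac
  by_contra! h
  obtain ⟨hf, hg⟩ := h
  have h1 : ∃ i, c.repr f i ≠ 0 := by
    by_contra! h
    exact hf (c.repr.map_eq_zero_iff.1 (Finsupp.ext h))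
  have h2 : ∃ i, c.repr g i ≠ 0 := by
    by_contra! h
    exact hg (c.repr.map_eq_zero_iff.1 (Finsupp.ext h))
  obtain ⟨i, hi⟩ := h1
  obtain ⟨j, hj⟩ := h2
  exact mul_ne_zero hi hj (hpt i j)

variable (K D D') in
theorem isDomain_tensorProduct_of_isAlgClosed : IsDomain (D ⊗[K] D') := by
  have : Nontrivial (D ⊗[K] D') :=
    Algebra.TensorProduct.nontrivial_of_algebraMap_injective_of_isDomain K D D'
      (FaithfulSMul.algebraMap_injective K D) (FaithfulSMul.algebraMap_injective K D')
  have : NoZeroDivisors (D ⊗[K] D') := by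
    refine ⟨fun {f g} hfg => ?_⟩
    -- Both factors come from a finitely generated subalgebra of `D'`.
    obtain ⟨C₁, hC₁, hf⟩ := exists_fg_and_mem_baseChange f
    obtain ⟨C₂, hC₂, hg⟩ := exists_fg_and_mem_baseChange g
    have hmono : ∀ {C₁ C₂ : Subalgebra K D'}, C₁ ≤ C₂ → C₁.baseChange D ≤ C₂.baseChange D := by
      intro C₁ C₂ h
      rintro _ ⟨t, rfl⟩
      exact ⟨Algebra.TensorProduct.map (.id D D) (Subalgebra.inclusion h) t, by
        induction t with
        | zero => simp
        | add s t hs ht => simp only [map_add, hs, ht]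
        | tmul x y => simp⟩
    obtain ⟨f', rfl⟩ := hmono (le_sup_left : C₁ ≤ C₁ ⊔ C₂) hf
    obtain ⟨g', rfl⟩ := hmono (le_sup_right : C₂ ≤ C₁ ⊔ C₂) hg
    have : Algebra.FiniteType K ↥(C₁ ⊔ C₂) :=
      (C₁ ⊔ C₂).fg_iff_finiteType.1 (hC₁.sup hC₂)
    have := noZeroDivisors_tensorProduct_of_finiteType (K := K) (D := ↥(C₁ ⊔ C₂)) (D' := D)
    have hinj : Function.Injective
        (Algebra.TensorProduct.map (.id D D) (C₁ ⊔ C₂).val : D ⊗[K] ↥(C₁ ⊔ C₂) →ₐ[D] D ⊗[K] D') :=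
      Module.Flat.lTensor_preserves_injective_linearMap (M := D) (C₁ ⊔ C₂).val.toLinearMap
        Subtype.val_injective
    have hfg' : f' * g' = 0 := hinj (by
      rw [map_mul, map_zero]
      exact hfg)
    let e := Algebra.TensorProduct.comm K D ↥(C₁ ⊔ C₂)
    have : e f' * e g' = 0 := by rw [← map_mul, hfg', map_zero]
    rcases mul_eq_zero.1 this with h | h
    · left
      rw [e.map_eq_zero_iff.1 h, map_zero]
    · right
      rw [e.map_eq_zero_iff.1 h, map_zero]
  exact NoZeroDivisors.to_isDomain _

end Domain

/-! ### Dévissage along associated primes -/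

section Devissage

universe u

variable {K A : Type*} [CommRing K] [CommRing A] [Algebra K A]

lemma isAssociatedPrime_of_eq_colon {X : Type*} [AddCommGroup X] [Module A X] {p : Ideal A}
    [hp : p.IsPrime] {x : X} (h : p = (⊥ : Submodule A X).colon {x}) : p ∈ associatedPrimes A X :=
  ⟨hp, x, by rw [← h, hp.radical]⟩

variable [IsNoetherianRing A]

/-- If `q` is the annihilator of the class of `x` modulo the elements annihilated by `p`, then it is
the annihilator of `a x` for one of the generators `a` of `p`. -/
lemma associatedPrimes_quotient_torsionBySet_subset {X : Type*} [AddCommGroup X] [Module A X]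
    (p : Ideal A) :
    associatedPrimes A (X ⧸ Submodule.torsionBySet A X p) ⊆ associatedPrimes A X := by
  intro q hq
  obtain ⟨hqp, x, hx⟩ := isAssociatedPrime_iff.1 (show IsAssociatedPrime q _ from hq)
  induction x using Submodule.Quotient.induction_on with | _ x
  have hmem : ∀ r, r ∈ q ↔ ∀ a ∈ p, r • a • x = 0 := by
    intro r
    rw [hx, Submodule.mem_colon_singleton, Submodule.mem_bot, ← Submodule.Quotient.mk_smul,
      Submodule.Quotient.mk_eq_zero, Submodule.mem_torsionBySet_iff]
    exact ⟨fun h a ha => by rw [smul_comm]; exact h ⟨a, ha⟩,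
      fun h a => by rw [← h a a.2, smul_comm]⟩
  obtain ⟨s, hs⟩ : p.FG := IsNoetherian.noetherian p
  have hle : s.inf (fun a => (⊥ : Submodule A X).colon {a • x}) ≤ q := by
    intro r hr
    rw [hmem]
    intro a ha
    rw [← hs] at ha
    induction ha using Submodule.span_induction with
    | mem a ha =>
      have := Finset.inf_le (f := fun a => (⊥ : Submodule A X).colon {a • x}) ha hr
      simpa using this
    | zero => simp
    | add a b _ _ ha hb => rw [add_smul, smul_add, ha, hb, add_zero]
    | smul c a _ ha => rw [smul_assoc, smul_comm, ha, smul_zero]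
  obtain ⟨a, ha, hle⟩ := (hqp.inf_le' (s := s)).1 hle
  refine isAssociatedPrime_of_eq_colon (x := a • x) (le_antisymm (fun r hr => ?_) hle)
  simpa using (hmem r).1 hr a (hs ▸ Submodule.subset_span ha)

/-- Dévissage: a property of modules that is stable under extensions and holds for torsion-free
modules over `A / p` for the associated primes `p` of `M` holds for `M`. For a maximal
associated prime `p`, the elements annihilated by `p` form a torsion-free module over `A / p`, and
the quotient by them has no new associated primes. -/
theorem devissage_associatedPrimes {M : Type u} [AddCommGroup M] [Module K M] [Module A M]
    [IsScalarTower K A M] [Module.Finite A M]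
    (P : ∀ (X : Type u) [AddCommGroup X] [Module K X] [Module A X] [IsScalarTower K A X], Prop)
    (subsingleton : ∀ (X : Type u) [AddCommGroup X] [Module K X] [Module A X]
      [IsScalarTower K A X] [Subsingleton X], P X)
    (extension : ∀ (X : Type u) [AddCommGroup X] [Module K X] [Module A X] [IsScalarTower K A X]
      (W : Submodule A X), P W → P (X ⧸ W) → P X)
    (torsionFree : ∀ (X : Type u) [AddCommGroup X] [Module K X] [Module A X] [IsScalarTower K A X],
      ∀ p ∈ associatedPrimes A M, (∀ a ∈ p, ∀ x : X, a • x = 0) →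
        (∀ a ∉ p, ∀ x : X, a • x = 0 → x = 0) → P X) : P M := by
  -- Noetherian induction over the quotients of `M` without new associated primes.
  suffices H : ∀ (U : Submodule A M) (X : Type u) [AddCommGroup X] [Module K X] [Module A X]
      [IsScalarTower K A X] (g : M →ₗ[A] X), Function.Surjective g → LinearMap.ker g = U →
      associatedPrimes A X ⊆ associatedPrimes A M → P X from
    H ⊥ M .id Function.surjective_id LinearMap.ker_id le_rfl
  intro U
  induction U using WellFoundedGT.induction with | _ U ih
  intro X _ _ _ _ g hg hU hAss
  rcases subsingleton_or_nontrivial X with hX | hX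
  · exact subsingleton X
  obtain ⟨p, hp, hmax⟩ := set_has_maximal_iff_noetherian.2 ‹IsNoetherianRing A› _
    (associatedPrimes.nonempty A X)
  obtain ⟨hpp, u, hu⟩ := isAssociatedPrime_iff.1 (show IsAssociatedPrime p X from hp)
  have hmem : ∀ x : X, x ∈ Submodule.torsionBySet A X p ↔ ∀ a ∈ p, a • x = 0 := fun x => by
    simp [Submodule.mem_torsionBySet_iff]
  refine extension X (Submodule.torsionBySet A X p) ?_ ?_
  · refine torsionFree _ p (hAss hp) ?_ ?_
    · rintro a ha ⟨x, hx⟩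
      exact Subtype.ext ((hmem x).1 hx a ha)
    · rintro a ha ⟨x, hx⟩ hax
      by_contra hx0
      have hx0 : x ≠ 0 := fun h => hx0 (Subtype.ext h)
      obtain ⟨q, hq, hle⟩ := exists_le_isAssociatedPrime_of_isNoetherianRing A x hx0
      have hpx : p ≤ (⊥ : Submodule A X).colon {x} := fun b hb => by
        simpa using (hmem x).1 hx b hb
      have hpq : p = q := by
        by_contra hne
        exact hmax q hq (lt_of_le_of_ne (hpx.trans hle) hne)
      refine ha (hpq ▸ hle ?_)
      simpa using congrArg Subtype.val hax
  · refine ih (LinearMap.ker ((Submodule.mkQ _).comp g)) ?_ _ ((Submodule.mkQ _).comp g)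
      ((Submodule.mkQ_surjective _).comp hg) rfl
      ((associatedPrimes_quotient_torsionBySet_subset p).trans hAss)
    rw [← hU]
    refine lt_of_le_of_ne (fun m hm => ?_) fun h => ?_
    · rw [LinearMap.mem_ker] at hm ⊢
      simp [hm]
    · obtain ⟨m, rfl⟩ := hg u
      have hmu : m ∈ LinearMap.ker ((Submodule.torsionBySet A X (p : Set A)).mkQ.comp g) := by
        rw [LinearMap.mem_ker, LinearMap.comp_apply, Submodule.mkQ_apply,
          Submodule.Quotient.mk_eq_zero, hmem]
        intro a ha
        simpa [hu] using ha
      rw [← h, LinearMap.mem_ker] at hmu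
      rw [hmu] at hu
      exact hpp.ne_top (by rw [hu]; simp)

end Devissage

/-! ### Associated primes of a tensor product -/

section AssociatedPrimes

universe u v

variable {K A B M N : Type*} [Field K] [CommRing A] [Algebra K A] [CommRing B] [Algebra K B]
  [AddCommGroup M] [Module K M] [Module A M] [IsScalarTower K A M]
  [AddCommGroup N] [Module K N] [Module B N] [IsScalarTower K B N]

/-- Over `A / p`, a torsion-free module embeds into a vector space over the field of fractions;
its coordinates are `A`-linear and remain jointly injective after tensoring with `N`. -/
lemma eq_zero_of_forall_fractionRing_of_torsionFree (N : Type*) [AddCommGroup N] [Module K N]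
    [Module B N] [IsScalarTower K B N] (p : Ideal A) [p.IsPrime] (h0 : ∀ a ∈ p, ∀ x : M, a • x = 0)
    (h1 : ∀ a ∉ p, ∀ x : M, a • x = 0 → x = 0) :
    ∀ t : M ⊗[K] N, (∀ φ : M →ₗ[A] FractionRing (A ⧸ p),
      tensorMap (K := K) φ (.id : N →ₗ[B] N) t = 0) → t = 0 := by
  intro t ht
  have htor : Module.IsTorsionBySet A M p := fun x a => h0 a a.2 x
  let : Module (A ⧸ p) M := htor.module
  have : IsScalarTower A (A ⧸ p) M := htor.isScalarTower
  let V := LocalizedModule (nonZeroDivisors (A ⧸ p)) M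
  let j : M →ₗ[A ⧸ p] V := LocalizedModule.mkLinearMap _ _
  have hj : Function.Injective j := by
    rw [injective_iff_map_eq_zero]
    intro x hx
    obtain ⟨s, hs⟩ := (IsLocalizedModule.eq_zero_iff (nonZeroDivisors (A ⧸ p)) j).1 hx
    obtain ⟨a, ha⟩ := Ideal.Quotient.mk_surjective (s : A ⧸ p)
    have hap : a ∉ p := by
      rw [← Ideal.Quotient.eq_zero_iff_mem, ha]
      exact nonZeroDivisors.coe_ne_zero s
    refine h1 a hap x ?_
    have hs : (s : A ⧸ p) • x = 0 := hs
    rwa [← ha] at hs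
  let c := Module.Free.chooseBasis (FractionRing (A ⧸ p)) V
  let F : M →ₗ[A ⧸ p] (Module.Free.ChooseBasisIndex (FractionRing (A ⧸ p)) V →₀
      FractionRing (A ⧸ p)) := (c.repr.toLinearMap.restrictScalars (A ⧸ p)).comp j
  have hF : Function.Injective F := c.repr.injective.comp hj
  let F' := (F.restrictScalars A).restrictScalars K
  have hFt : Function.Injective (LinearMap.rTensor N F') :=
    Module.Flat.rTensor_preserves_injective_linearMap F' hF
  refine hFt ?_
  rw [map_zero]
  refine (TensorProduct.finsuppLeft K K _ N _).map_eq_zero_iff.1 (Finsupp.ext fun i => ?_)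
  rw [TensorProduct.finsuppLeft_apply, ← LinearMap.rTensor_comp_apply]
  exact ht (((Finsupp.lapply i).comp F).restrictScalars A)

/-- Exchanging the factors is compatible with the actions of `A ⊗ B` and `B ⊗ A`. -/
lemma comm_smul (f : A ⊗[K] B) (t : M ⊗[K] N) :
    TensorProduct.comm K M N (f • t) =
      Algebra.TensorProduct.comm K A B f • TensorProduct.comm K M N t := by
  induction f with
  | zero => simp
  | add f g hf hg => rw [add_smul, map_add, hf, hg, map_add, add_smul]
  | tmul a b =>
    induction t with
    | zero => simp
    | add s t hs ht => rw [smul_add, map_add, hs, ht, map_add, smul_add]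
    | tmul x y => simp [tensorTensorModule_smul_tmul]

lemma isSMulRegular_comm_iff (f : A ⊗[K] B) :
    IsSMulRegular (N ⊗[K] M) (Algebra.TensorProduct.comm K A B f) ↔ IsSMulRegular (M ⊗[K] N) f :=
  ((TensorProduct.comm K M N).toEquiv.isSMulRegular_congr (comm_smul f)).symm

/-- Regularity of `f` on `M ⊗ N` may be tested with `M` replaced by the fields of fractions of the
`A / p`, for `p` an associated prime of `M`. -/
lemma isSMulRegular_tensor_left [IsNoetherianRing A] [Module.Finite A M] {f : A ⊗[K] B}
    (h : ∀ p ∈ associatedPrimes A M, IsSMulRegular (FractionRing (A ⧸ p) ⊗[K] N) f) :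
    IsSMulRegular (M ⊗[K] N) f := by
  refine devissage_associatedPrimes (K := K) (A := A) (M := M)
    (fun X => IsSMulRegular (X ⊗[K] N) f) ?_ ?_ ?_
  · intro X _ _ _ _ _ s t _
    exact Subsingleton.elim s t
  · intro X _ _ _ _ W h1 h2
    exact isSMulRegular_of_range_eq_ker
      (f := tensorMap (K := K) W.subtype (.id : N →ₗ[B] N)) (g := tensorMap (K := K) W.mkQ .id)
      (tensorMap_injective W.injective_subtype Function.injective_id)
      (LinearMap.exact_iff.1 (tensorMap_id_exact (LinearMap.exact_subtype_mkQ W)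
        W.mkQ_surjective)).symm h1 h2
  · intro X _ _ _ _ p hp h0 h1
    have : p.IsPrime := IsAssociatedPrime.isPrime hp
    rw [isSMulRegular_iff_right_eq_zero_of_smul]
    intro t ht
    refine eq_zero_of_forall_fractionRing_of_torsionFree (K := K) (B := B) N p h0 h1 t fun φ =>
      (h p hp).right_eq_zero_of_smul ?_
    rw [← map_smul, ht, map_zero]

/-- On a tensor product of algebras the action of `A ⊗ B` is multiplication. -/
lemma smul_eq_map_mul {L L' : Type*} [CommRing L] [CommRing L'] [Algebra K L] [Algebra K L']
    [Algebra A L] [Algebra B L'] [IsScalarTower K A L] [IsScalarTower K B L'] (f : A ⊗[K] B)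
    (t : L ⊗[K] L') :
    f • t = Algebra.TensorProduct.map (IsScalarTower.toAlgHom K A L)
      (IsScalarTower.toAlgHom K B L') f * t := by
  induction f with
  | zero => simp
  | add f g hf hg => rw [add_smul, map_add, hf, hg, add_mul]
  | tmul a b =>
    induction t with
    | zero => simp
    | add s t hs ht => rw [smul_add, hs, ht, mul_add]
    | tmul x y => simp [tensorTensorModule_smul_tmul, Algebra.smul_def]

variable (K) in
/-- The ideal `p ⊗ B + A ⊗ q`, as the kernel of `A ⊗ B → A / p ⊗ B / q`. -/
noncomputable def tensorPrime (p : Ideal A) (q : Ideal B) : Ideal (A ⊗[K] B) :=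
  RingHom.ker (Algebra.TensorProduct.map (Ideal.Quotient.mkₐ K p) (Ideal.Quotient.mkₐ K q))

variable (K) in
/-- The residue ring of `A ⊗ B` at `p ⊗ B + A ⊗ q` is `A / p ⊗ B / q`. -/
noncomputable def quotientTensorPrimeEquiv (p : Ideal A) (q : Ideal B) :
    ((A ⊗[K] B) ⧸ tensorPrime K p q) ≃+* (A ⧸ p) ⊗[K] (B ⧸ q) :=
  RingHom.quotientKerEquivOfSurjective
    (f := (Algebra.TensorProduct.map (Ideal.Quotient.mkₐ K p) (Ideal.Quotient.mkₐ K q)).toRingHom)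
    (TensorProduct.map_surjective (Ideal.Quotient.mkₐ_surjective K p)
      (Ideal.Quotient.mkₐ_surjective K q))

variable [IsAlgClosed K]

instance isPrime_tensorPrime (p : Ideal A) (q : Ideal B) [p.IsPrime] [q.IsPrime] :
    (tensorPrime K p q).IsPrime := by
  have := isDomain_tensorProduct_of_isAlgClosed K (A ⧸ p) (B ⧸ q)
  exact RingHom.ker_isPrime _

lemma isSMulRegular_fractionRing_tensor {p : Ideal A} {q : Ideal B} [p.IsPrime] [q.IsPrime]
    {f : A ⊗[K] B} (hf : f ∉ tensorPrime K p q) :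
    IsSMulRegular (FractionRing (A ⧸ p) ⊗[K] FractionRing (B ⧸ q)) f := by
  have := isDomain_tensorProduct_of_isAlgClosed K (FractionRing (A ⧸ p)) (FractionRing (B ⧸ q))
  rw [isSMulRegular_iff_right_eq_zero_of_smul]
  intro t ht
  rw [smul_eq_map_mul] at ht
  refine (mul_eq_zero.1 ht).resolve_left fun h => hf ?_
  let g := IsScalarTower.toAlgHom K (A ⧸ p) (FractionRing (A ⧸ p))
  let g' := IsScalarTower.toAlgHom K (B ⧸ q) (FractionRing (B ⧸ q))
  have hinj : Function.Injective (Algebra.TensorProduct.map g g') :=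
    TensorProduct.map_injective_of_flat_flat g.toLinearMap g'.toLinearMap
      (IsFractionRing.injective _ _) (IsFractionRing.injective _ _)
  rw [tensorPrime, RingHom.mem_ker]
  refine hinj ?_
  rw [map_zero, ← h]
  change (Algebra.TensorProduct.map g g').comp
    (Algebra.TensorProduct.map (Ideal.Quotient.mkₐ K p) (Ideal.Quotient.mkₐ K q)) f = _
  rw [← Algebra.TensorProduct.map_comp]
  rfl

lemma tensorPrime_mem_associatedPrimes [IsNoetherianRing A] [IsNoetherianRing B] {p : Ideal A}
    {q : Ideal B} (hp : p ∈ associatedPrimes A M) (hq : q ∈ associatedPrimes B N) :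
    tensorPrime K p q ∈ associatedPrimes (A ⊗[K] B) (M ⊗[K] N) := by
  obtain ⟨hpp, g, hg⟩ := (isAssociatedPrime_iff_exists_injective_linearMap p M).1 hp
  obtain ⟨hqp, h, hh⟩ := (isAssociatedPrime_iff_exists_injective_linearMap q N).1 hq
  refine associatedPrimes.subset_of_injective (tensorMap_injective (K := K) hg hh) ?_
  refine isAssociatedPrime_of_eq_colon (x := 1) ?_
  ext f
  rw [Submodule.mem_colon_singleton, Submodule.mem_bot, smul_eq_map_mul, mul_one]
  rfl

lemma exists_le_tensorPrime [IsNoetherianRing A] [IsNoetherianRing B] [Module.Finite A M]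
    [Module.Finite B N] {Q : Ideal (A ⊗[K] B)}
    (hQ : Q ∈ associatedPrimes (A ⊗[K] B) (M ⊗[K] N)) :
    ∃ p ∈ associatedPrimes A M, ∃ q ∈ associatedPrimes B N, Q ≤ tensorPrime K p q := by
  have hfin := ((associatedPrimes.finite A M).prod (associatedPrimes.finite B N))
  have hsub : (Q : Set (A ⊗[K] B)) ⊆ ⋃ z ∈ associatedPrimes A M ×ˢ associatedPrimes B N,
      (tensorPrime K z.1 z.2 : Set (A ⊗[K] B)) := by
    intro f hf
    by_contra hcon
    simp only [Set.mem_iUnion, not_exists] at hcon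
    -- Dévissage in `M`, and then, after exchanging the factors, in `N`.
    have hreg : IsSMulRegular (M ⊗[K] N) f := by
      refine isSMulRegular_tensor_left fun p hp => ?_
      rw [← isSMulRegular_comm_iff]
      refine isSMulRegular_tensor_left fun q hq => ?_
      rw [isSMulRegular_comm_iff]
      have : p.IsPrime := IsAssociatedPrime.isPrime hp
      have : q.IsPrime := IsAssociatedPrime.isPrime hq
      exact isSMulRegular_fractionRing_tensor (hcon (p, q) ⟨hp, hq⟩)
    -- Associated primes are radicals of annihilators, so only a power of `f` annihilates `t`.
    obtain ⟨hQp, t, rfl⟩ := hQ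
    obtain ⟨n, hn⟩ := hf
    rw [Submodule.mem_colon_singleton, Submodule.mem_bot] at hn
    have := (hreg.pow n).right_eq_zero_of_smul hn
    exact hQp.ne_top (by simp [this])
  obtain ⟨z, hz, hle⟩ := (Q.subset_union_prime_finite hfin
    (f := fun z => tensorPrime K z.1 z.2) (⊥, ⊥) (⊥, ⊥) fun z hz _ _ => by
      have : z.1.IsPrime := IsAssociatedPrime.isPrime hz.1
      have : z.2.IsPrime := IsAssociatedPrime.isPrime hz.2
      infer_instance).1 hsub
  exact ⟨z.1, hz.1, z.2, hz.2, hle⟩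

end AssociatedPrimes

/-! ### Maximal depth of a tensor product -/

section MaximalDepthTensor

universe u v

/-- If all associated primes lie below the prime `m` and have finite dimension, then depth and
mdepth are natural numbers, and the first is at most the second. -/
lemma exists_moduleMdepth_eq {R : Type*} [CommRing R] [IsNoetherianRing R] {M : Type v}
    [AddCommGroup M] [Module R M] [Module.Finite R M] [Nontrivial M] {m : Ideal R} [m.IsPrime]
    (hm : ∀ p ∈ associatedPrimes R M, p ≤ m)
    (hd : ∀ p ∈ associatedPrimes R M, ringKrullDim (R ⧸ p) < ⊤) :
    ∃ n e : ℕ, HasMaximalRegularSequence m n M ∧ moduleMdepth R M = e ∧ n ≤ e ∧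
      ∃ p ∈ associatedPrimes R M, ringKrullDim (R ⧸ p) = e := by
  have : Nonempty (associatedPrimes R M) := (associatedPrimes.nonempty R M).to_subtype
  obtain ⟨⟨p, hp⟩, hpe⟩ :=
    ciInf_mem fun p : associatedPrimes R M => ringKrullDim (R ⧸ (p : Ideal R))
  have : p.IsPrime := IsAssociatedPrime.isPrime hp
  obtain ⟨n, hn, hle⟩ := exists_hasMaximalRegularSequence_le hp (hm p hp) (hd p hp)
  obtain ⟨e, he⟩ : ∃ e : ℕ, ringKrullDim (R ⧸ p) = e := by
    have h1 := hd p hp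
    have h2 : (0 : WithBot ℕ∞) ≤ ringKrullDim (R ⧸ p) := ringKrullDim_nonneg_of_nontrivial
    generalize ringKrullDim (R ⧸ p) = e at h1 h2
    induction e with
    | bot => exact absurd h2 (by simp)
    | coe e =>
      induction e with
      | top => exact absurd h1 (by simp)
      | coe e => exact ⟨e, rfl⟩
  refine ⟨n, e, hn, hpe.symm.trans he, ?_, p, hp, he⟩
  rw [he] at hle
  exact_mod_cast hle

lemma moduleMdepth_le {R : Type*} [CommRing R] {M : Type v} [AddCommGroup M] [Module R M]
    {p : Ideal R} (hp : p ∈ associatedPrimes R M) : moduleMdepth R M ≤ ringKrullDim (R ⧸ p) :=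
  iInf_le (fun p : associatedPrimes R M => ringKrullDim (R ⧸ (p : Ideal R))) ⟨p, hp⟩

lemma HasMaximalRegularSequence.hasMaximalDepth_iff {R : Type*} [CommRing R] [IsNoetherianRing R]
    {M : Type v} [AddCommGroup M] [Module R M] [Module.Finite R M] {m : Ideal R} {n e : ℕ}
    (h : HasMaximalRegularSequence m n M) (he : moduleMdepth R M = e) :
    HasMaximalDepth M m ↔ n = e := by
  rw [HasMaximalDepth, h.moduleDepth_eq, he]
  norm_cast

/-- If dimensions of residue domains are additive under `⊗`, then depth and mdepth are both additive
under `⊗`; since depth is at most mdepth, equality holds for `M ⊗ N` if and only if it holds for `M`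
and for `N`. -/
theorem hasMaximalDepth_tensor_iff {K A B : Type*} {M : Type u} {N : Type v} [Field K]
    [IsAlgClosed K] [CommRing A] [Algebra K A] [IsNoetherianRing A]
    [CommRing B] [Algebra K B] [IsNoetherianRing B] [IsNoetherianRing (A ⊗[K] B)]
    [AddCommGroup M] [Module K M] [Module A M] [IsScalarTower K A M]
    [Module.Finite A M] [Nontrivial M]
    [AddCommGroup N] [Module K N] [Module B N] [IsScalarTower K B N]
    [Module.Finite B N] [Nontrivial N] {mA : Ideal A} {mB : Ideal B} [mA.IsPrime] [mB.IsPrime]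
    (hA : ∀ p ∈ associatedPrimes A M, p ≤ mA) (hB : ∀ q ∈ associatedPrimes B N, q ≤ mB)
    (hdA : ∀ p ∈ associatedPrimes A M, ringKrullDim (A ⧸ p) < ⊤)
    (hdB : ∀ q ∈ associatedPrimes B N, ringKrullDim (B ⧸ q) < ⊤)
    (hd : ∀ p ∈ associatedPrimes A M, ∀ q ∈ associatedPrimes B N,
      ringKrullDim ((A ⧸ p) ⊗[K] (B ⧸ q)) = ringKrullDim (A ⧸ p) + ringKrullDim (B ⧸ q)) :
    HasMaximalDepth (M ⊗[K] N) (tensorIdeal K mA mB) ↔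
      HasMaximalDepth M mA ∧ HasMaximalDepth N mB := by
  obtain ⟨n, e, hn, he, hne, p₀, hp₀, hp₀e⟩ := exists_moduleMdepth_eq hA hdA
  obtain ⟨n', e', hn', he', hne', q₀, hq₀, hq₀e⟩ := exists_moduleMdepth_eq hB hdB
  have hdim : ∀ p ∈ associatedPrimes A M, ∀ q ∈ associatedPrimes B N,
      ringKrullDim ((A ⊗[K] B) ⧸ tensorPrime K p q) =
        ringKrullDim (A ⧸ p) + ringKrullDim (B ⧸ q) := fun p hp q hq =>
    (ringKrullDim_eq_of_ringEquiv (quotientTensorPrimeEquiv K p q)).trans (hd p hp q hq)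
  have hmd : moduleMdepth (A ⊗[K] B) (M ⊗[K] N) = (e + e' : ℕ) := by
    apply le_antisymm
    · refine (moduleMdepth_le (tensorPrime_mem_associatedPrimes hp₀ hq₀)).trans ?_
      rw [hdim p₀ hp₀ q₀ hq₀, hp₀e, hq₀e]
      exact_mod_cast le_rfl
    · refine le_iInf fun ⟨Q, hQ⟩ => ?_
      obtain ⟨p, hp, q, hq, hle⟩ := exists_le_tensorPrime hQ
      calc ((e + e' : ℕ) : WithBot ℕ∞) = moduleMdepth A M + moduleMdepth B N := by
            rw [he, he']; norm_cast
        _ ≤ ringKrullDim (A ⧸ p) + ringKrullDim (B ⧸ q) :=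
            add_le_add (moduleMdepth_le hp) (moduleMdepth_le hq)
        _ = ringKrullDim ((A ⊗[K] B) ⧸ tensorPrime K p q) := (hdim p hp q hq).symm
        _ ≤ ringKrullDim ((A ⊗[K] B) ⧸ Q) :=
            ringKrullDim_le_of_surjective (Ideal.Quotient.factor hle)
              (Ideal.Quotient.factor_surjective hle)
  have := finite_tensor K A B M N
  rw [(hn.tensor (K := K) hn').hasMaximalDepth_iff hmd, hn.hasMaximalDepth_iff he,
    hn'.hasMaximalDepth_iff he']
  omega

end MaximalDepthTensor

/-! ### Dimension of a tensor product of finitely generated algebras -/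

section Dimension

lemma ringKrullDim_eq_of_isIntegral_of_injective {R S : Type*} [CommRing R] [CommRing S]
    (f : R →+* S) (hf : f.IsIntegral) (hinj : Function.Injective f) :
    ringKrullDim R = ringKrullDim S := by
  algebraize [f]
  apply le_antisymm
  · refine iSup_le fun l => ?_
    obtain ⟨P, -, hP, hPl⟩ := Ideal.exists_ideal_over_prime_of_isIntegral (S := S)
      l.head.asIdeal ⊥ (by
        intro x hx
        have hx0 : f x = 0 := hx
        rw [(map_eq_zero_iff f hinj).1 hx0]
        exact zero_mem _)
    have : P.LiesOver l.head.asIdeal := ⟨hPl.symm⟩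
    obtain ⟨L, hL, -⟩ := Ideal.exists_ltSeries_of_hasGoingUp l P
    rw [← hL]
    exact Order.LTSeries.length_le_krullDim L
  · refine Order.krullDim_le_of_strictMono (PrimeSpectrum.comap (algebraMap R S)) fun I J h => ?_
    exact Ideal.IsIntegral.comap_lt_comap h

variable {K A B : Type*} [Field K] [CommRing A] [Algebra K A] [CommRing B] [Algebra K B]

lemma isIntegral_tensorProduct_map {P Q : Type*} [CommRing P] [Algebra K P] [CommRing Q]
    [Algebra K Q] {g : P →ₐ[K] A} {h : Q →ₐ[K] B} (hg : g.toRingHom.IsIntegral)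
    (hh : h.toRingHom.IsIntegral) :
    (Algebra.TensorProduct.map g h).toRingHom.IsIntegral := by
  intro t
  induction t with
  | zero => exact RingHom.isIntegralElem_zero _
  | add s t hs ht => exact hs.add _ ht
  | tmul a b =>
    have h1 : a ⊗ₜ[K] b = (a ⊗ₜ[K] (1 : B)) * ((1 : A) ⊗ₜ[K] b) := by simp
    rw [h1]
    refine RingHom.IsIntegralElem.mul _ ?_ ?_
    · obtain ⟨p, hp, hpa⟩ := hg a
      let i : P →ₐ[K] P ⊗[K] Q := Algebra.TensorProduct.includeLeft
      refine ⟨p.map i.toRingHom, hp.map _, ?_⟩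
      rw [Polynomial.eval₂_map]
      have h2 : (Algebra.TensorProduct.map g h).toRingHom.comp i.toRingHom =
          (Algebra.TensorProduct.includeLeft : A →ₐ[K] A ⊗[K] B).toRingHom.comp g.toRingHom := by
        ext x
        simp [i]
      rw [h2]
      have := congrArg (Algebra.TensorProduct.includeLeft : A →ₐ[K] A ⊗[K] B).toRingHom hpa
      rwa [Polynomial.hom_eval₂, map_zero] at this
    · obtain ⟨p, hp, hpb⟩ := hh b
      let i : Q →ₐ[K] P ⊗[K] Q := Algebra.TensorProduct.includeRight
      refine ⟨p.map i.toRingHom, hp.map _, ?_⟩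
      rw [Polynomial.eval₂_map]
      have h2 : (Algebra.TensorProduct.map g h).toRingHom.comp i.toRingHom =
          (Algebra.TensorProduct.includeRight : B →ₐ[K] A ⊗[K] B).toRingHom.comp h.toRingHom := by
        ext x
        simp [i]
      rw [h2]
      have := congrArg (Algebra.TensorProduct.includeRight : B →ₐ[K] A ⊗[K] B).toRingHom hpb
      rwa [Polynomial.hom_eval₂, map_zero] at this

variable (K) in
lemma exists_ringKrullDim_eq_of_finiteType (A : Type*) [CommRing A] [Algebra K A] [Nontrivial A]
    [Algebra.FiniteType K A] :
    ∃ (s : ℕ) (g : MvPolynomial (Fin s) K →ₐ[K] A), Function.Injective g ∧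
      g.toRingHom.IsIntegral ∧ ringKrullDim A = s := by
  obtain ⟨s, g, hg, hi⟩ := exists_integral_inj_algHom_of_fg K A
  refine ⟨s, g, hg, hi, ?_⟩
  rw [← ringKrullDim_eq_of_isIntegral_of_injective g.toRingHom hi hg,
    MvPolynomial.ringKrullDim_of_isNoetherianRing, ringKrullDim_eq_zero_of_field]
  simp

variable (K A B) in
/-- By Noether normalization, `A ⊗ B` is integral over a polynomial ring in `dim A + dim B`
variables. -/
lemma ringKrullDim_tensorProduct_of_finiteType [Nontrivial A] [Nontrivial B]
    [Algebra.FiniteType K A] [Algebra.FiniteType K B] :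
    ringKrullDim (A ⊗[K] B) = ringKrullDim A + ringKrullDim B := by
  obtain ⟨s, g, hg, hgi, hA⟩ := exists_ringKrullDim_eq_of_finiteType K A
  obtain ⟨t, h, hh, hhi, hB⟩ := exists_ringKrullDim_eq_of_finiteType K B
  have hinj : Function.Injective (Algebra.TensorProduct.map g h) :=
    TensorProduct.map_injective_of_flat_flat g.toLinearMap h.toLinearMap hg hh
  rw [← ringKrullDim_eq_of_isIntegral_of_injective (Algebra.TensorProduct.map g h).toRingHom
    (isIntegral_tensorProduct_map hgi hhi) hinj, hA, hB,
    ringKrullDim_eq_of_ringEquiv (MvPolynomial.algebraTensorAlgEquiv (σ := Fin t) K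
      (MvPolynomial (Fin s) K)).toRingEquiv,
    MvPolynomial.ringKrullDim_of_isNoetherianRing, MvPolynomial.ringKrullDim_of_isNoetherianRing,
    ringKrullDim_eq_zero_of_field]
  simp

end Dimension

/-! ### Local tensor products -/

section Local

variable {K A B : Type*} [Field K] [CommRing A] [Algebra K A] [CommRing B] [Algebra K B]

lemma exists_isPrime_transcendental_quotient {a : A} (ha : Transcendental K a) :
    ∃ p : Ideal A, p.IsPrime ∧ Transcendental K (Ideal.Quotient.mk p a) := by
  rw [transcendental_iff_injective] at ha
  let S := (nonZeroDivisors (Polynomial K)).map (Polynomial.aeval a)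
  have hS : Disjoint ((⊥ : Ideal A) : Set A) S := by
    rw [Set.disjoint_left]
    rintro _ h0 ⟨f, hf, rfl⟩
    refine nonZeroDivisors.ne_zero hf (ha ?_)
    rw [map_zero]
    exact h0
  obtain ⟨p, hp, -, hdis⟩ := Ideal.exists_le_prime_disjoint ⊥ S hS
  refine ⟨p, hp, transcendental_iff.2 fun f hf => ?_⟩
  by_contra hf0
  refine Set.disjoint_left.1 hdis ?_ ⟨f, mem_nonZeroDivisors_of_ne_zero hf0, rfl⟩
  change Polynomial.aeval (Ideal.Quotient.mkₐ K p a) f = 0 at hf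
  rw [Polynomial.aeval_algHom_apply] at hf
  exact Ideal.Quotient.eq_zero_iff_mem.1 hf

lemma not_isUnit_sub_of_transcendental_of_isDomain [IsDomain A] [IsDomain B] {a : A} {b : B}
    (ha : Transcendental K a) (hb : Transcendental K b) :
    ¬ IsUnit (a ⊗ₜ[K] (1 : B) - (1 : A) ⊗ₜ[K] b) := by
  rw [transcendental_iff_injective] at ha hb
  let := (Polynomial.aeval (R := K) a).toRingHom.toAlgebra
  let := (Polynomial.aeval (R := K) b).toRingHom.toAlgebra
  have : IsScalarTower K (Polynomial K) A :=
    .of_algebraMap_eq fun k => (Polynomial.aeval_C a k).symm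
  have : IsScalarTower K (Polynomial K) B :=
    .of_algebraMap_eq fun k => (Polynomial.aeval_C b k).symm
  have : Nontrivial (A ⊗[Polynomial K] B) :=
    Algebra.TensorProduct.nontrivial_of_algebraMap_injective_of_isDomain _ A B ha hb
  let φ : A ⊗[K] B →ₐ[K] A ⊗[Polynomial K] B :=
    Algebra.TensorProduct.lift
      ((Algebra.TensorProduct.includeLeft : A →ₐ[Polynomial K] _).restrictScalars K)
      ((Algebra.TensorProduct.includeRight : B →ₐ[Polynomial K] _).restrictScalars K)
      fun _ _ => .all _ _
  intro h
  refine (h.map φ).ne_zero ?_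
  have h1 : algebraMap (Polynomial K) A Polynomial.X = a := Polynomial.aeval_X a
  have h2 : algebraMap (Polynomial K) B Polynomial.X = b := Polynomial.aeval_X b
  have h3 : a ⊗ₜ[Polynomial K] (1 : B) = (1 : A) ⊗ₜ[Polynomial K] b := by
    rw [← h1, ← h2, Algebra.algebraMap_eq_smul_one, Algebra.algebraMap_eq_smul_one,
      TensorProduct.smul_tmul]
  simp [φ, h3]

/-- For transcendental `a` and `b`, the rings `A` and `B` have prime quotients that are
torsion-free over `K[X]`, with `X` acting by `a` and by `b`. The tensor product of these quotients
over `K[X]` is a nonzero quotient of `A ⊗ B` in which `a` and `b` agree. -/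
lemma not_isUnit_sub_of_transcendental {a : A} {b : B} (ha : Transcendental K a)
    (hb : Transcendental K b) : ¬ IsUnit (a ⊗ₜ[K] (1 : B) - (1 : A) ⊗ₜ[K] b) := by
  obtain ⟨p, hp, hpa⟩ := exists_isPrime_transcendental_quotient ha
  obtain ⟨q, hq, hqb⟩ := exists_isPrime_transcendental_quotient hb
  intro h
  refine not_isUnit_sub_of_transcendental_of_isDomain hpa hqb ?_
  simpa using h.map
    (Algebra.TensorProduct.map (Ideal.Quotient.mkₐ K p) (Ideal.Quotient.mkₐ K q))

/-- If `A ⊗ B` is local, then `A` or `B` is algebraic over `K`: otherwise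
`a ⊗ 1 - 1 ⊗ b` and `a ⊗ 1 - 1 ⊗ (b + 1)` would be two nonunits with difference `1`. -/
lemma isAlgebraic_or_isAlgebraic_of_isLocalRing [IsLocalRing (A ⊗[K] B)] :
    Algebra.IsAlgebraic K A ∨ Algebra.IsAlgebraic K B := by
  by_contra! hcon
  rw [← Algebra.transcendental_iff_not_isAlgebraic,
    ← Algebra.transcendental_iff_not_isAlgebraic] at hcon
  obtain ⟨⟨a, ha⟩, ⟨b, hb⟩⟩ := hcon
  have hb' : Transcendental K (b + 1) := fun h => hb (by simpa using h.sub isAlgebraic_one)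
  have h := IsLocalRing.nonunits_add (not_isUnit_sub_of_transcendental ha hb)
    (mt (IsUnit.neg_iff _).1 (not_isUnit_sub_of_transcendental ha hb'))
  refine h ?_
  have : a ⊗ₜ[K] (1 : B) - (1 : A) ⊗ₜ[K] b + -(a ⊗ₜ[K] (1 : B) - (1 : A) ⊗ₜ[K] (b + 1)) = 1 := by
    rw [TensorProduct.tmul_add, Algebra.TensorProduct.one_def]
    abel
  rw [this]
  exact isUnit_one

variable (K B) in
/-- If `D = K`, then `D ⊗ B` is `B`. -/
noncomputable def tensorEquivOfBijective {D : Type*} [CommRing D] [Algebra K D]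
    (h : Function.Bijective (algebraMap K D)) : D ⊗[K] B ≃ₐ[K] B :=
  (Algebra.TensorProduct.congr (AlgEquiv.ofBijective (Algebra.ofId K D) h).symm .refl).trans
    (Algebra.TensorProduct.lid K B)

variable (K B) in
lemma ringKrullDim_tensorProduct_of_bijective {D : Type*} [CommRing D] [Algebra K D]
    (h : Function.Bijective (algebraMap K D)) :
    ringKrullDim (D ⊗[K] B) = ringKrullDim D + ringKrullDim B := by
  have h0 : ringKrullDim D = 0 := by
    rw [← ringKrullDim_eq_of_ringEquiv (RingEquiv.ofBijective (algebraMap K D) h),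
      ringKrullDim_eq_zero_of_field]
  rw [h0, zero_add]
  exact ringKrullDim_eq_of_ringEquiv (tensorEquivOfBijective K B h).toRingEquiv

lemma tensorIdeal_eq_tensorPrime (p : Ideal A) (q : Ideal B) :
    tensorIdeal K p q = tensorPrime K p q := by
  have hp : RingHom.ker (Ideal.Quotient.mkₐ K p) = p := Ideal.mk_ker
  have hq : RingHom.ker (Ideal.Quotient.mkₐ K q) = q := Ideal.mk_ker
  rw [tensorPrime, Algebra.TensorProduct.map_ker _ _ (Ideal.Quotient.mkₐ_surjective K p)
    (Ideal.Quotient.mkₐ_surjective K q), hp, hq]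
  rfl

lemma isMaximal_tensorIdeal_of_isField {p : Ideal A} {q : Ideal B}
    (h : IsField ((A ⧸ p) ⊗[K] (B ⧸ q))) : (tensorIdeal K p q).IsMaximal := by
  rw [tensorIdeal_eq_tensorPrime]
  exact Ideal.Quotient.maximal_of_isField _
    ((quotientTensorPrimeEquiv K p q).toMulEquiv.isField h)

variable [IsAlgClosed K]

/-- A domain that is algebraic over the algebraically closed field `K` is `K`. -/
lemma bijective_algebraMap_quotient [Algebra.IsAlgebraic K A] (p : Ideal A) [p.IsPrime] :
    Function.Bijective (algebraMap K (A ⧸ p)) := by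
  have : Algebra.IsIntegral K A := Algebra.IsAlgebraic.isIntegral
  have : Algebra.IsIntegral K (A ⧸ p) := inferInstance
  exact IsAlgClosed.algebraMap_bijective_of_isIntegral

/-- A local tensor product has residue domains with additive dimension, and its maximal ideal is
generated by the maximal ideals of the factors, since one of the factors has all its residue domains
equal to `K`. -/
lemma ringKrullDim_and_maximalIdeal_of_isLocalRing_tensor [IsLocalRing A] [IsLocalRing B]
    [IsLocalRing (A ⊗[K] B)] :
    (∀ (p : Ideal A) (q : Ideal B), p.IsPrime → q.IsPrime →
      ringKrullDim ((A ⧸ p) ⊗[K] (B ⧸ q)) = ringKrullDim (A ⧸ p) + ringKrullDim (B ⧸ q)) ∧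
    IsLocalRing.maximalIdeal (A ⊗[K] B) =
      tensorIdeal K (IsLocalRing.maximalIdeal A) (IsLocalRing.maximalIdeal B) := by
  rcases isAlgebraic_or_isAlgebraic_of_isLocalRing (K := K) (A := A) (B := B) with h | h
  · refine ⟨fun p q hp hq => ringKrullDim_tensorProduct_of_bijective K _
      (bijective_algebraMap_quotient p), (IsLocalRing.eq_maximalIdeal
        (isMaximal_tensorIdeal_of_isField ?_)).symm⟩
    refine (tensorEquivOfBijective K _ (bijective_algebraMap_quotient _)).toMulEquiv.isField ?_
    exact (Ideal.Quotient.maximal_ideal_iff_isField_quotient _).1 inferInstance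
  · refine ⟨fun p q hp hq => ?_, (IsLocalRing.eq_maximalIdeal
        (isMaximal_tensorIdeal_of_isField ?_)).symm⟩
    · rw [add_comm, ← ringKrullDim_tensorProduct_of_bijective K (A ⧸ p)
        (bijective_algebraMap_quotient (K := K) q)]
      exact ringKrullDim_eq_of_ringEquiv (Algebra.TensorProduct.comm K _ _).toRingEquiv
    · refine ((Algebra.TensorProduct.comm K _ _).trans
        (tensorEquivOfBijective K _ (bijective_algebraMap_quotient _))).toMulEquiv.isField ?_
      exact (Ideal.Quotient.maximal_ideal_iff_isField_quotient _).1 inferInstance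

end Local

/-! ### Standard graded algebras -/

section GradedAlgebras

variable {K A B M : Type*} [Field K] [CommRing A] [Algebra K A] [CommRing B] [Algebra K B]
  [AddCommGroup M] [Module K M] [Module A M]

lemma IsStandardGraded.finiteType {𝒜 : ℕ → Submodule K A} [GradedAlgebra 𝒜]
    (h : IsStandardGraded 𝒜) : Algebra.FiniteType K A := by
  obtain ⟨s, hs⟩ := (Submodule.fg_top (𝒜 1)).1 h.finite_degree_one.fg_top
  refine ⟨⟨s, ?_⟩⟩
  rw [← Algebra.adjoin_span, hs, h.generated]

lemma gradedMaximalIdeal_le_irrelevant (𝒜 : ℕ → Submodule K A) [GradedAlgebra 𝒜] :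
    gradedMaximalIdeal 𝒜 ≤ RingHom.ker (GradedRing.projZeroRingHom 𝒜) := by
  refine Ideal.span_le.2 ?_
  rintro a ⟨n, hn, ha⟩
  exact DirectSum.decompose_of_mem_ne 𝒜 ha hn.ne'

lemma sub_projZero_mem_gradedMaximalIdeal (𝒜 : ℕ → Submodule K A) [GradedAlgebra 𝒜] (a : A) :
    a - GradedRing.projZeroRingHom 𝒜 a ∈ gradedMaximalIdeal 𝒜 := by
  induction a using DirectSum.Decomposition.inductionOn 𝒜 with
  | zero => simp
  | @homogeneous i a =>
    rcases Nat.eq_zero_or_pos i with rfl | hi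
    · rw [GradedRing.projZeroRingHom_apply, DirectSum.decompose_of_mem_same 𝒜 a.2, sub_self]
      exact zero_mem _
    · rw [GradedRing.projZeroRingHom_apply, DirectSum.decompose_of_mem_ne 𝒜 a.2 hi.ne', sub_zero]
      exact Ideal.subset_span ⟨i, hi, a.2⟩
  | add a b ha hb =>
    rw [map_add, add_sub_add_comm]
    exact add_mem ha hb

/-- Elements of `A` are scalars modulo the graded maximal ideal. -/
lemma IsStandardGraded.exists_sub_algebraMap_mem {𝒜 : ℕ → Submodule K A} [GradedAlgebra 𝒜]
    (h : IsStandardGraded 𝒜) (a : A) :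
    ∃ c : K, a - algebraMap K A c ∈ gradedMaximalIdeal 𝒜 := by
  have h0 : GradedRing.projZeroRingHom 𝒜 a ∈ 𝒜 0 := SetLike.coe_mem _
  rw [h.degree_zero, Submodule.mem_one] at h0
  obtain ⟨c, hc⟩ := h0
  exact ⟨c, hc ▸ sub_projZero_mem_gradedMaximalIdeal 𝒜 a⟩

lemma IsStandardGraded.isMaximal {𝒜 : ℕ → Submodule K A} [GradedAlgebra 𝒜] [Nontrivial A]
    (h : IsStandardGraded 𝒜) : (gradedMaximalIdeal 𝒜).IsMaximal := by
  refine Ideal.isMaximal_iff.2 ⟨fun h1 => ?_, fun J a hJ ha haJ => ?_⟩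
  · have := gradedMaximalIdeal_le_irrelevant 𝒜 h1
    rw [RingHom.mem_ker, map_one] at this
    exact one_ne_zero this
  · obtain ⟨c, hc⟩ := h.exists_sub_algebraMap_mem a
    have hc0 : c ≠ 0 := by
      rintro rfl
      exact ha (by simpa using hc)
    have : algebraMap K A c ∈ J := by simpa using J.sub_mem haJ (hJ hc)
    have := J.mul_mem_left (algebraMap K A c⁻¹) this
    rwa [← map_mul, inv_mul_cancel₀ hc0, map_one] at this

/-- A homogeneous element of degree `i` shifts homogeneous components by `i`. -/
lemma decompose_smul_of_mem {𝒜 : ℕ → Submodule K A} {ℳ : ℤ → Submodule K M}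
    [DirectSum.Decomposition ℳ] (hℳ : IsModuleGrading 𝒜 ℳ) {i : ℕ} {a : A} (ha : a ∈ 𝒜 i) (k : ℤ)
    (x : M) :
    (DirectSum.decompose ℳ (a • x) (i + k) : M) = a • (DirectSum.decompose ℳ x k : M) := by
  induction x using DirectSum.Decomposition.inductionOn ℳ with
  | zero => simp
  | @homogeneous l x =>
    have hax := hℳ.smul_mem i l a ha x x.2
    by_cases hlk : l = k
    · subst hlk
      rw [DirectSum.decompose_of_mem_same ℳ hax, DirectSum.decompose_of_mem_same ℳ x.2]
    · rw [DirectSum.decompose_of_mem_ne ℳ hax (by omega), DirectSum.decompose_of_mem_ne ℳ x.2 hlk,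
        smul_zero]
  | add x y hx hy =>
    simp only [smul_add, DirectSum.decompose_add, DirectSum.add_apply, Submodule.coe_add, hx, hy]

lemma decompose_smul_eq_zero_of_lt {𝒜 : ℕ → Submodule K A} [GradedAlgebra 𝒜]
    {ℳ : ℤ → Submodule K M} [DirectSum.Decomposition ℳ] (hℳ : IsModuleGrading 𝒜 ℳ) {x : M} {j : ℤ}
    (hx : ∀ k < j, (DirectSum.decompose ℳ x k : M) = 0) (a : A) :
    ∀ k < j, (DirectSum.decompose ℳ (a • x) k : M) = 0 := by
  intro k hk
  induction a using DirectSum.Decomposition.inductionOn 𝒜 with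
  | zero => simp
  | @homogeneous i a =>
    have := decompose_smul_of_mem hℳ a.2 (k - i) x
    rwa [add_sub_cancel, hx _ (by omega), smul_zero] at this
  | add a b ha hb =>
    simp only [add_smul, DirectSum.decompose_add, DirectSum.add_apply, Submodule.coe_add, ha, hb,
      add_zero]

/-- Multiplication by elements of the graded maximal ideal raises the lowest degree. -/
lemma decompose_smul_eq_zero_of_mem {𝒜 : ℕ → Submodule K A} [GradedAlgebra 𝒜]
    {ℳ : ℤ → Submodule K M} [DirectSum.Decomposition ℳ] (hℳ : IsModuleGrading 𝒜 ℳ) {x : M} {j : ℤ}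
    (hx : ∀ k < j, (DirectSum.decompose ℳ x k : M) = 0) {b : A} (hb : b ∈ gradedMaximalIdeal 𝒜) :
    ∀ k < j + 1, (DirectSum.decompose ℳ (b • x) k : M) = 0 := by
  induction hb using Submodule.span_induction with
  | mem b hb =>
    obtain ⟨n, hn, hb⟩ := hb
    intro k hk
    have := decompose_smul_of_mem hℳ hb (k - n) x
    rwa [add_sub_cancel, hx _ (by omega), smul_zero] at this
  | zero => simp
  | add a b _ _ ha hb =>
    intro k hk
    simp only [add_smul, DirectSum.decompose_add, DirectSum.add_apply, Submodule.coe_add,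
      ha k hk, hb k hk, add_zero]
  | smul a b _ hb =>
    rw [smul_eq_mul, mul_smul]
    exact decompose_smul_eq_zero_of_lt hℳ hb a

/-- An element `c + b` with `c` a nonzero scalar and `b` in the graded maximal ideal does not
annihilate a nonzero `x`: it multiplies the lowest component of `x` by `c`. -/
lemma IsStandardGraded.associatedPrimes_le [IsScalarTower K A M] [IsNoetherianRing A]
    {𝒜 : ℕ → Submodule K A} [GradedAlgebra 𝒜] (h : IsStandardGraded 𝒜) {ℳ : ℤ → Submodule K M}
    (hℳ : IsModuleGrading 𝒜 ℳ) {p : Ideal A} (hp : p ∈ associatedPrimes A M) :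
    p ≤ gradedMaximalIdeal 𝒜 := by
  classical
  let : DirectSum.Decomposition ℳ := hℳ.isInternal.chooseDecomposition
  obtain ⟨hpp, x, rfl⟩ := isAssociatedPrime_iff.1 (show IsAssociatedPrime p M from hp)
  intro a ha
  have hax : a • x = 0 := by simpa using ha
  obtain ⟨c, hc⟩ := h.exists_sub_algebraMap_mem a
  have hne : (DirectSum.decompose ℳ x).support.Nonempty := by
    rw [Finset.nonempty_iff_ne_empty, Ne, DFinsupp.support_eq_empty]
    intro h0
    have hx0 : x = 0 := (DirectSum.decompose ℳ).injective (by rw [h0, DirectSum.decompose_zero])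
    exact hpp.ne_top (by simp [hx0])
  obtain ⟨j, hj, hmin⟩ := Finset.exists_min_image _ id hne
  have hlow : ∀ k < j, (DirectSum.decompose ℳ x k : M) = 0 := by
    intro k hk
    by_contra hk0
    have := hmin k (DFinsupp.mem_support_iff.2 fun h0 => hk0 (by rw [h0]; rfl))
    exact absurd hk (not_lt.2 this)
  have h1 := decompose_smul_eq_zero_of_mem hℳ hlow hc j (lt_add_one j)
  rw [sub_smul, hax, zero_sub, algebraMap_smul, DirectSum.decompose_neg,
    DirectSum.decompose_smul] at h1
  have h2 : c • (DirectSum.decompose ℳ x j : M) = 0 := neg_eq_zero.1 h1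
  have hc0 : c = 0 := (smul_eq_zero.1 h2).resolve_right fun h0 =>
    DFinsupp.mem_support_iff.1 hj (Subtype.ext h0)
  simpa [hc0] using hc

lemma gradedMaximalIdeal_tensorGrading (𝒜 : ℕ → Submodule K A) (ℬ : ℕ → Submodule K B)
    [GradedAlgebra 𝒜] [GradedAlgebra ℬ] :
    gradedMaximalIdeal (tensorGrading 𝒜 ℬ) =
      tensorIdeal K (gradedMaximalIdeal 𝒜) (gradedMaximalIdeal ℬ) := by
  apply le_antisymm
  · refine Ideal.span_le.2 ?_
    rintro t ⟨n, hn, ht⟩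
    have hle : tensorGrading 𝒜 ℬ n ≤
        (tensorIdeal K (gradedMaximalIdeal 𝒜) (gradedMaximalIdeal ℬ)).restrictScalars K := by
      refine Submodule.span_le.2 ?_
      rintro _ ⟨i, j, hij, a, ha, b, hb, rfl⟩
      have h1 : a ⊗ₜ[K] b = (a ⊗ₜ[K] (1 : B)) * ((1 : A) ⊗ₜ[K] b) := by simp
      change a ⊗ₜ[K] b ∈ tensorIdeal K (gradedMaximalIdeal 𝒜) (gradedMaximalIdeal ℬ)
      rw [h1]
      rcases Nat.eq_zero_or_pos i with rfl | hi
      · exact Ideal.mul_mem_left _ _ (one_tmul_mem_tensorIdeal _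
          (Ideal.subset_span ⟨j, by omega, hb⟩))
      · exact Ideal.mul_mem_right _ _ (tmul_one_mem_tensorIdeal _ (Ideal.subset_span ⟨i, hi, ha⟩))
    exact hle ht
  · refine sup_le (Ideal.map_le_iff_le_comap.2 (Ideal.span_le.2 ?_))
      (Ideal.map_le_iff_le_comap.2 (Ideal.span_le.2 ?_))
    · rintro a ⟨n, hn, ha⟩
      exact Ideal.subset_span ⟨n, hn, Submodule.subset_span
        ⟨n, 0, add_zero n, a, ha, 1, SetLike.one_mem_graded ℬ, rfl⟩⟩
    · rintro b ⟨n, hn, hb⟩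
      exact Ideal.subset_span ⟨n, hn, Submodule.subset_span
        ⟨0, n, zero_add n, 1, SetLike.one_mem_graded 𝒜, b, hb, rfl⟩⟩

end GradedAlgebras

/-! ### The local and the graded case -/

theorem mainTheorem7 {K A B M N : Type*} [Field K] [IsAlgClosed K]
    [CommRing A] [Algebra K A] [IsNoetherianRing A]
    [CommRing B] [Algebra K B] [IsNoetherianRing B]
    [IsNoetherianRing (A ⊗[K] B)]
    [AddCommGroup M] [Module K M] [Module A M] [IsScalarTower K A M]
    [Module.Finite A M] [Nontrivial M]
    [AddCommGroup N] [Module K N] [Module B N] [IsScalarTower K B N]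
    [Module.Finite B N] [Nontrivial N] :
    -- local rings
    (∀ [IsLocalRing A] [IsLocalRing B] [IsLocalRing (A ⊗[K] B)],
      HasMaximalDepth (M ⊗[K] N) (IsLocalRing.maximalIdeal (A ⊗[K] B)) ↔
        HasMaximalDepth M (IsLocalRing.maximalIdeal A) ∧
        HasMaximalDepth N (IsLocalRing.maximalIdeal B)) ∧
    -- standard graded algebras and graded modules
    (∀ (𝒜 : ℕ → Submodule K A) (ℬ : ℕ → Submodule K B) [GradedAlgebra 𝒜] [GradedAlgebra ℬ],
      IsStandardGraded 𝒜 → IsStandardGraded ℬ →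
      ∀ (ℳ : ℤ → Submodule K M) (𝒩 : ℤ → Submodule K N),
        IsModuleGrading 𝒜 ℳ → IsModuleGrading ℬ 𝒩 →
        (HasMaximalDepth (M ⊗[K] N) (gradedMaximalIdeal (tensorGrading 𝒜 ℬ)) ↔
          HasMaximalDepth M (gradedMaximalIdeal 𝒜) ∧
          HasMaximalDepth N (gradedMaximalIdeal ℬ))) := by
  constructor
  · intro _ _ _
    obtain ⟨hd, hm⟩ :=
      ringKrullDim_and_maximalIdeal_of_isLocalRing_tensor (K := K) (A := A) (B := B)
    rw [hm]
    refine hasMaximalDepth_tensor_iff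
      (fun p hp => IsLocalRing.le_maximalIdeal (IsAssociatedPrime.isPrime hp).ne_top)
      (fun q hq => IsLocalRing.le_maximalIdeal (IsAssociatedPrime.isPrime hq).ne_top)
      (fun p _ => (ringKrullDim_quotient_le p).trans_lt ringKrullDim_lt_top)
      (fun q _ => (ringKrullDim_quotient_le q).trans_lt ringKrullDim_lt_top)
      fun p hp q hq => hd p q (IsAssociatedPrime.isPrime hp) (IsAssociatedPrime.isPrime hq)
  · intro 𝒜 ℬ _ _ hA hB ℳ 𝒩 hM hN
    have : Nontrivial A := Module.nontrivial A M
    have : Nontrivial B := Module.nontrivial B N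
    have := hA.isMaximal
    have := hB.isMaximal
    have := hA.finiteType
    have := hB.finiteType
    rw [gradedMaximalIdeal_tensorGrading]
    refine hasMaximalDepth_tensor_iff (fun p hp => hA.associatedPrimes_le hM hp)
      (fun q hq => hB.associatedPrimes_le hN hq) (fun p _ => ?_) (fun q _ => ?_)
      fun p hp q hq => ?_
    · refine (ringKrullDim_quotient_le p).trans_lt ?_
      obtain ⟨s, -, -, -, hs⟩ := exists_ringKrullDim_eq_of_finiteType K A
      rw [hs]
      exact WithBot.coe_lt_coe.2 (ENat.natCast_lt_top s)
    · refine (ringKrullDim_quotient_le q).trans_lt ?_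
      obtain ⟨s, -, -, -, hs⟩ := exists_ringKrullDim_eq_of_finiteType K B
      rw [hs]
      exact WithBot.coe_lt_coe.2 (ENat.natCast_lt_top s)
    · have : p.IsPrime := IsAssociatedPrime.isPrime hp
      have : q.IsPrime := IsAssociatedPrime.isPrime hq
      exact ringKrullDim_tensorProduct_of_finiteType K (A ⧸ p) (B ⧸ q)
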